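/- **Setting.** Let $n\ge 1$, $B^*\in\mathbb R^{d\times m}\setminus\{0\}$, $\sigma>0$, and $\theta^*:\{1,\dots,n\}\to\{0,1,\dots,n\}$. Let $x_1,\dots,x_n$ be i.i.d. $N(0,I_d)$ and, independently of them, let $\varepsilon_1,\dots,\varepsilon_n$ be i.i.d. $N(0,I_m)$. If $\theta^*(i)\ne 0$, then $y_i=B^{*\top}x_{\theta^*(i)}+\sigma\varepsilon_i$; the family of the $y_i$ with $\theta^*(i)=0$ (the missing matches) is random, independent of $(x_j)_j$, and otherwise arbitrary. Let $\Theta^*\in\{0,1\}^{n\times n}$ have entries $\Theta^*_{ij}=1$ iff $\theta^*(i)=j$. Put $$\gamma^2=\min_{i<j}\frac{\|B^{*\top}(x_i-x_j)\|_2^2}{\|B^*\|_F^2},\qquad \gamma_0^2=\min_{i:\,\theta^*(i)=0,\ 1\le j\le n}\frac{\|y_i-B^{*\top}x_j\|_2^2}{\|B^*\|_F^2},\qquad \mathsf{SNR}=\frac{\|B^*\|_F^2}{\sigma^2m},$$ where a minimum over the empty set is $+\infty$. For a matrix $B$ and a (possibly random) threshold $\tau$ let $\hat j(i)$ be a (measurably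 chosen) minimizer of $j\mapsto\|y_i-B^\top x_j\|_2$, and let $\widehat\Theta(B)\in\{0,1\}^{n\times n}$ have entries $\widehat\Theta_{ij}(B)=1$ iff $j=\hat j(i)$ and $\|y_i-B^\top x_{\hat j(i)}\|_2\le\tau$. **Achievability.** Let $\widehat B=\widehat B(X,Y)$ be any estimator of $B^*$ and suppose that almost surely $$\tau>\tau_0:=\sigma(\sqrt m+2\sqrt{\log n})+\max_{1\le j\le n}\|x_j\|_2\,\|B^*-\widehat B\|_2 ,$$ with $\|\cdot\|_2$ the spectral norm on matrices. Let $$\mathcal B=\Big\{\min\{\gamma_0^2,\gamma^2\}\,\mathsf{SNR}>36\max\Big\{\tfrac{\|\widehat B-B^*\|_2^2}{\sigma^2m}\max_{1\le i\le n}\|x_i\|_2^2,\ 2\Big(1+\sqrt{\tfrac{4\log n}{m}}\Big)^2,\ \tfrac{\tau^2}{\sigma^2m}\Big\}\Big\}.$$ Then $\mathbb P\big(\mathcal B\cap\{\widehat\Theta(\widehat B)=\Theta^*\}\big)\ge 1-\mathbb P(\mathcal B^c)-\tfrac1n$; also, if $\mathbb P(\mathcal B)>0$, $\mathbb P\big(\widehat\Theta(\widehat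 B)=\Theta^*\,\big|\,\mathcal B\big)\ge 1-\mathbb P(\mathcal B^c)-\tfrac1n$. **Converse.** Suppose now that $\theta^*(i)\ne0$ for all $i$, and consider $\widehat\Theta(B^*)$ with an arbitrary threshold $\tau$. * There is a universal constant $c>0$ such that $\mathsf{SNR}<c\,\frac{\log n}{m}$ implies $\mathbb P(\widehat\Theta(B^*)\ne\Theta^*)\ge\frac13$. * For every $M$ there is a constant $c'>0$ that depends only on $M$ such that, if $m\le M$, the following holds for the event $\mathcal C=\{\min\{\gamma_0^2,\gamma^2\}\,\mathsf{SNR}<c'\}$ (which depends on $X$ only). (a) Almost surely on the part of $\mathcal C$ where some pair $i\ne j$ that attains the minimum in $\gamma^2$ has a member in the range of $\theta^*$, $\mathbb P(\widehat\Theta(B^*)\ne\Theta^*\mid X)\ge\frac13$. In particular this holds almost surely on all of $\mathcal C$ if $\theta^*$ is a permutation. (b) If the range of $\theta^*$ has at least $n/2$ elements (in particular if $\theta^*(i)=i$ for all but at most $n/2$ indices $i$) and $\mathbb P(\mathcal C)>0$, then $\mathbb P(\widehat\Theta(B^*)\ne\Theta^*\mid\mathcal C)\ge\frac13$. -/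

import Mathlib

open MeasureTheory ProbabilityTheory
open scoped ENNReal

noncomputable section

namespace RecordLinkage

/-- `ℝᵏ` with the Euclidean norm. -/
abbrev E (k : ℕ) : Type := EuclideanSpace ℝ (Fin k)

/-- The linear predictor `Bᵀ x ∈ ℝᵐ` of `x ∈ ℝᵈ`. -/
def linPred {d m : ℕ} (B : Matrix (Fin d) (Fin m) ℝ) (x : E d) : E m :=
  WithLp.toLp 2 (B.transpose.mulVec x.ofLp)

/-- The squared Frobenius norm. -/
def frobSq {d m : ℕ} (B : Matrix (Fin d) (Fin m) ℝ) : ℝ := ∑ k, ∑ l, B k l ^ 2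

open scoped Matrix.Norms.L2Operator in
/-- The spectral norm (largest singular value). -/
def specNorm {d m : ℕ} (B : Matrix (Fin d) (Fin m) ℝ) : ℝ := ‖B‖

/-- The signal-to-noise ratio `‖B‖_F² / (σ² m)`. -/
def SNR {d m : ℕ} (B : Matrix (Fin d) (Fin m) ℝ) (σ : ℝ) : ℝ := frobSq B / (σ ^ 2 * m)

/-- The matching matrix of a correspondence `θ`, where `θ i = some j` says that the `i`-th response
is matched with the `j`-th predictor, and `θ i = none` that the `i`-th response has no match. -/
def matchingMatrix {n : ℕ} (θ : Fin n → Option (Fin n)) : Matrix (Fin n) (Fin n) ℝ :=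
  Matrix.of fun i j => if θ i = some j then 1 else 0

/-- The data `x₁, …, xₙ`, `y₁, …, yₙ` and the errors `ε₁, …, εₙ` follow the multivariate linear
model with correspondence `θ`, coefficient matrix `B` and noise level `σ`: the `xᵢ` are i.i.d.
`N(0, I_d)`, the `εᵢ` are i.i.d. `N(0, I_m)` and independent of the `xᵢ`, a matched response is
`yᵢ = Bᵀ x_{θ(i)} + σ εᵢ`, and the family of unmatched responses is independent of the `xᵢ`. -/
structure IsLinkageModel {n d m : ℕ} {Ω : Type*} [MeasurableSpace Ω] (P : Measure Ω)
    (θ : Fin n → Option (Fin n)) (B : Matrix (Fin d) (Fin m) ℝ) (σ : ℝ)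
    (x : Fin n → Ω → E d) (y : Fin n → Ω → E m) (ε : Fin n → Ω → E m) : Prop where
  measurable_x : ∀ i, Measurable (x i)
  measurable_y : ∀ i, Measurable (y i)
  measurable_ε : ∀ i, Measurable (ε i)
  law_x : ∀ i, P.map (x i) = stdGaussian (E d)
  indep_x : iIndepFun x P
  law_ε : ∀ i, P.map (ε i) = stdGaussian (E m)
  indep_ε : iIndepFun ε P
  indep_x_ε : IndepFun (fun ω i => x i ω) (fun ω i => ε i ω) P
  matched : ∀ i j, θ i = some j → ∀ ω, y i ω = linPred B (x j ω) + σ • ε i ω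
  indep_unmatched :
    IndepFun (fun ω (i : {i : Fin n // θ i = none}) => y i.1 ω) (fun ω i => x i ω) P

/-- `γ² = min_{i < j} ‖Bᵀ (xᵢ - xⱼ)‖² / ‖B‖_F²`, with value `∞` if there is no pair `i < j`. -/
def gammaSq {n d m : ℕ} (B : Matrix (Fin d) (Fin m) ℝ) (x : Fin n → E d) : ℝ≥0∞ :=
  ⨅ (i : Fin n) (j : Fin n) (_ : i < j), ENNReal.ofReal (‖linPred B (x i - x j)‖ ^ 2 / frobSq B)

/-- `γ₀² = min_{θ(i) = none, 1 ≤ j ≤ n} ‖yᵢ - Bᵀ xⱼ‖² / ‖B‖_F²`, with value `∞` if every response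
is matched. -/
def gammaZeroSq {n d m : ℕ} (θ : Fin n → Option (Fin n)) (B : Matrix (Fin d) (Fin m) ℝ)
    (x : Fin n → E d) (y : Fin n → E m) : ℝ≥0∞ :=
  ⨅ (i : Fin n) (_ : θ i = none) (j : Fin n),
    ENNReal.ofReal (‖y i - linPred B (x j)‖ ^ 2 / frobSq B)

/-- `min {γ₀², γ²} · SNR`. -/
def separation {n d m : ℕ} (θ : Fin n → Option (Fin n)) (B : Matrix (Fin d) (Fin m) ℝ) (σ : ℝ)
    (x : Fin n → E d) (y : Fin n → E m) : ℝ≥0∞ :=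
  min (gammaZeroSq θ B x y) (gammaSq B x) * ENNReal.ofReal (SNR B σ)

/-- `jhat i` is a minimizing index of `j ↦ ‖yᵢ - Bᵀ xⱼ‖` for every `i`. -/
def IsNearest {n d m : ℕ} (B : Matrix (Fin d) (Fin m) ℝ) (x : Fin n → E d) (y : Fin n → E m)
    (jhat : Fin n → Fin n) : Prop :=
  ∀ i j, ‖y i - linPred B (x (jhat i))‖ ≤ ‖y i - linPred B (x j)‖

open scoped Classical in
/-- The thresholded nearest neighbour matching `Θ̂(B)` with threshold `τ` and minimizing indices
`jhat`. -/
def matchingEstimator {n d m : ℕ} (B : Matrix (Fin d) (Fin m) ℝ) (x : Fin n → E d)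
    (y : Fin n → E m) (τ : ℝ) (jhat : Fin n → Fin n) : Matrix (Fin n) (Fin n) ℝ :=
  Matrix.of fun i j => if j = jhat i ∧ ‖y i - linPred B (x (jhat i))‖ ≤ τ then 1 else 0

/-- The critical threshold
`τ₀ = σ (√m + 2 √(log n)) + max_j ‖xⱼ‖ · ‖B - Bhat‖₂`. -/
def tauZero {n d m : ℕ} (B Bhat : Matrix (Fin d) (Fin m) ℝ) (σ : ℝ) (x : Fin n → E d) : ℝ :=
  σ * (√(m : ℝ) + 2 * √(Real.log n)) + (⨆ j, ‖x j‖) * specNorm (B - Bhat)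

/-- The inequality that defines the event `𝓑`. -/
def WellSeparated {n d m : ℕ} (θ : Fin n → Option (Fin n)) (B Bhat : Matrix (Fin d) (Fin m) ℝ)
    (σ τ : ℝ) (x : Fin n → E d) (y : Fin n → E m) : Prop :=
  ENNReal.ofReal (36 * max (specNorm (Bhat - B) ^ 2 / (σ ^ 2 * m) * ⨆ i, ‖x i‖ ^ 2)
    (max (2 * (1 + √(4 * Real.log n / m)) ^ 2) (τ ^ 2 / (σ ^ 2 * m)))) < separation θ B σ x y

/-- Some pair `i ≠ j` that attains the minimum in `γ²` has a member which is matched with some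
response. -/
def ClosestPairMatched {n d m : ℕ} (θ : Fin n → Option (Fin n)) (B : Matrix (Fin d) (Fin m) ℝ)
    (x : Fin n → E d) : Prop :=
  ∃ i j, i ≠ j ∧ ENNReal.ofReal (‖linPred B (x i - x j)‖ ^ 2 / frobSq B) = gammaSq B x ∧
    some i ∈ Set.range θ

/-- The random matrix `ω ↦ Bhat (X(ω), Y(ω))` that an estimator `Bhat` yields on the data. -/
def plugIn {n d m : ℕ} {Ω : Type*} (Bhat : (Fin n → E d) → (Fin n → E m) → Matrix (Fin d) (Fin m) ℝ)
    (x : Fin n → Ω → E d) (y : Fin n → Ω → E m) (ω : Ω) : Matrix (Fin d) (Fin m) ℝ :=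
  Bhat (fun i => x i ω) (fun i => y i ω)

/-- The event `𝓑`, for the (random) coefficient matrix `C` in place of `B` in the estimator. -/
def goodEvent {n d m : ℕ} {Ω : Type*} (θ : Fin n → Option (Fin n)) (B : Matrix (Fin d) (Fin m) ℝ)
    (C : Ω → Matrix (Fin d) (Fin m) ℝ) (σ : ℝ) (τ : Ω → ℝ) (x : Fin n → Ω → E d)
    (y : Fin n → Ω → E m) : Set Ω :=
  {ω | WellSeparated θ B (C ω) σ (τ ω) (fun i => x i ω) (fun i => y i ω)}

/-- The event `Θ̂(C) = Θ*` of exact recovery. -/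
def recoveryEvent {n d m : ℕ} {Ω : Type*} (θ : Fin n → Option (Fin n))
    (C : Ω → Matrix (Fin d) (Fin m) ℝ) (τ : Ω → ℝ) (jhat : Ω → Fin n → Fin n)
    (x : Fin n → Ω → E d) (y : Fin n → Ω → E m) : Set Ω :=
  {ω | matchingEstimator (C ω) (fun i => x i ω) (fun i => y i ω) (τ ω) (jhat ω) =
    matchingMatrix θ}

/-- The event `min {γ₀², γ²} · SNR < c`. -/
def closeEvent {n d m : ℕ} {Ω : Type*} (θ : Fin n → Option (Fin n)) (B : Matrix (Fin d) (Fin m) ℝ)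
    (σ : ℝ) (x : Fin n → Ω → E d) (y : Fin n → Ω → E m) (c : ℝ) : Set Ω :=
  {ω | separation θ B σ (fun i => x i ω) (fun i => y i ω) < ENNReal.ofReal c}

end RecordLinkage

end

/-! Achievability is a triangle inequality on an event of probability at least `1 - 1/n`, where
every error has norm at most `√m + 2√(log n)` (`IsLinkageModel.large_error_le`: Chernoff and a union
bound). There `τ > τ₀` exceeds the distance from a response to its true match, while on `𝓑` every
wrong candidate stays farther away than `τ` (`matchingEstimator_eq_of_wellSeparated`).

Both converses use one mechanism: whatever the threshold, recovery fails once a response generated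
by `xⱼ` is nearer to `Bᵀxₖ` than to `Bᵀxⱼ`. Given `X` this is a half-space event for one error, of
probability at least `flipBound (‖w‖ / 2)` with `w = Bᵀ(xₖ - xⱼ)/σ`.

For small SNR, fix one competitor per response. Given `X` the flips are independent. Outside an
`X`-event of probability at most 1/4 (Markov) the squared lengths of the `w` have a small sum, and
convexity then bounds the probability of no flip by 5/12; together 2/3
(`IsLinkageModel.recovery_le`).

For bounded `m`, a closest pair gives a short `w`, hence failure with conditional probability at
least 4/9 if a member is matched (`IsLinkageModel.condExp_failure_ge`). The `xᵢ` are exchangeable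
and `γ²` is symmetric, so when half of the predictors are matched a closest pair misses all of them
with probability at most 1/4, even given `γ²`. Finally `3/4 · 4/9 = 1/3`. -/

noncomputable section

namespace RecordLinkage

open scoped RealInnerProductSpace

/-! ### Tail and half-space bounds for Gaussian vectors. -/

/-- The moment generating function of `Z²` for `Z ∼ N(0, 1)`. -/
lemma integral_exp_mul_sq_gaussianReal (s : ℝ) :
    ∫ z, Real.exp (s * z ^ 2) ∂gaussianReal 0 1 = (√(1 - 2 * s))⁻¹ := by
  rw [integral_gaussianReal_eq_integral_smul one_ne_zero]
  have h : ∀ z : ℝ, gaussianPDFReal 0 1 z • Real.exp (s * z ^ 2) =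
      (√(2 * Real.pi))⁻¹ * Real.exp (-(1 / 2 - s) * z ^ 2) := by
    intro z
    simp only [gaussianPDFReal, NNReal.coe_one, mul_one, sub_zero, smul_eq_mul]
    rw [mul_assoc, ← Real.exp_add]
    congr 2
    ring
  simp_rw [h]
  -- For `s ≥ 1/2` the integral diverges and both sides are 0 by convention, so no restriction on
  -- `s` is needed.
  rw [integral_const_mul, integral_gaussian, ← Real.sqrt_inv, ← Real.sqrt_inv,
    ← Real.sqrt_mul (by positivity)]
  congr 1
  rw [show (1 - 2 * s) = 2 * (1 / 2 - s) by ring]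
  rcases eq_or_ne (1 / 2 - s) 0 with h0 | h0
  · rw [h0]; simp
  · field_simp

lemma integral_exp_mul_norm_sq_stdGaussian (m : ℕ) (s : ℝ) :
    ∫ e, Real.exp (s * ‖e‖ ^ 2) ∂stdGaussian (E m) = (√(1 - 2 * s))⁻¹ ^ m := by
  rw [← map_pi_eq_stdGaussian, integral_map (by fun_prop)
    (Measurable.aestronglyMeasurable (by fun_prop))]
  have h : ∀ z : Fin m → ℝ, Real.exp (s * ‖WithLp.toLp 2 z‖ ^ 2) =
      ∏ i, Real.exp (s * z i ^ 2) := by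
    intro z
    rw [EuclideanSpace.real_norm_sq_eq, Finset.mul_sum, Real.exp_sum]
  simp_rw [h]
  rw [integral_fintype_prod_eq_prod (f := fun _ z => Real.exp (s * z ^ 2))]
  simp [integral_exp_mul_sq_gaussianReal]

/-- The Chernoff bound for the norm of a standard Gaussian vector. -/
lemma stdGaussian_norm_tail {m : ℕ} (hm : 0 < m) {t : ℝ} (ht : 0 ≤ t) :
    (stdGaussian (E m)).real {e | √m + t ≤ ‖e‖} ≤ Real.exp (-t ^ 2 / 2) := by
  set a := √(m : ℝ)
  have ha0 : 0 < a := Real.sqrt_pos.2 (by exact_mod_cast hm)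
  have ha2 : a ^ 2 = m := Real.sq_sqrt (by positivity)
  set r := a + t with hr
  have hr0 : 0 < r := by positivity
  -- The optimal Chernoff exponent: it minimizes `-s r² - (m/2) log (1 - 2s)`.
  set s := (1 - (a / r) ^ 2) / 2 with hs
  have hs0 : 0 ≤ s := by
    have : (a / r) ^ 2 ≤ 1 := by
      apply pow_le_one₀ (by positivity)
      rw [div_le_one hr0]; linarith
    rw [hs]; linarith
  have hsq : √(1 - 2 * s) = a / r := by
    rw [show 1 - 2 * s = (a / r) ^ 2 by rw [hs]; ring]
    exact Real.sqrt_sq (by positivity)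
  have hint := integral_exp_mul_norm_sq_stdGaussian m s
  -- A non-integrable function has integral 0 by convention, but the formula gives a positive value.
  have hI : Integrable (fun e : E m => Real.exp (s * ‖e‖ ^ 2)) (stdGaussian (E m)) := by
    by_contra hn
    rw [integral_undef hn, hsq] at hint
    have : 0 < (a / r)⁻¹ ^ m := by positivity
    linarith
  have key := measure_ge_le_exp_mul_mgf (μ := stdGaussian (E m))
    (X := fun e : E m => ‖e‖ ^ 2) (r ^ 2) hs0 hI
  have hset : {e : E m | r ≤ ‖e‖} = {e : E m | r ^ 2 ≤ ‖e‖ ^ 2} := by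
    ext e
    simp only [Set.mem_ofPred_eq]
    exact (pow_le_pow_iff_left₀ hr0.le (norm_nonneg _) two_ne_zero).symm
  rw [hset]
  refine key.trans ?_
  rw [mgf, hint, hsq, inv_div]
  -- From `1 + t/a ≤ exp (t/a)` and `m = a²`; the factor `exp (a t)` then cancels the cross term of
  -- `(a + t)²`.
  have h1 : (r / a) ^ m ≤ Real.exp (a * t) := by
    calc (r / a) ^ m ≤ (Real.exp (t / a)) ^ m := by
          gcongr
          have := Real.add_one_le_exp (t / a)
          rwa [show r / a = t / a + 1 by rw [hr]; field_simp; ring]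
      _ = Real.exp (a * t) := by
          rw [← Real.exp_nat_mul, ← ha2]
          congr 1; field_simp
  calc Real.exp (-s * r ^ 2) * (r / a) ^ m ≤ Real.exp (-s * r ^ 2) * Real.exp (a * t) := by gcongr
    _ = Real.exp (-t ^ 2 / 2) := by
        rw [← Real.exp_add]
        congr 1
        rw [hs]
        field_simp
        rw [hr]; ring

lemma stdGaussian_map_inner {m : ℕ} (u : E m) :
    (stdGaussian (E m)).map (fun e => ⟪u, e⟫) = gaussianReal 0 (‖u‖ ^ 2).toNNReal := by
  have h := IsGaussian.map_eq_gaussianReal (μ := stdGaussian (E m)) (innerSL ℝ u)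
  rw [integral_strongDual_stdGaussian, variance_dual_stdGaussian, innerSL_apply_norm] at h
  exact h

/-- A lower bound for the Gaussian tail that is sharp at `0`. -/
lemma gaussianReal_Ioi_ge {t : ℝ} (ht : 0 ≤ t) :
    1 / 2 * Real.exp (-(t ^ 2 / 2 + t)) ≤ (gaussianReal 0 1).real (Set.Ioi t) := by
  have hmap : (gaussianReal 0 1).real (Set.Ioi t) = (gaussianReal (-t) 1).real (Set.Ioi 0) := by
    rw [← zero_sub t, ← gaussianReal_map_sub_const t, measureReal_def, measureReal_def,
      Measure.map_apply (by fun_prop) measurableSet_Ioi]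
    congr 2
    ext z; simp
  have hq : ∀ f : ℝ → ℝ, ∫ z, gaussianPDFReal 0 1 z * f z = ∫ z, f z ∂gaussianReal 0 1 := by
    intro f
    rw [integral_gaussianReal_eq_integral_smul one_ne_zero]; rfl
  have hsq : ∫ z, z ^ 2 ∂gaussianReal 0 1 = 1 := by
    have h := variance_fun_id_gaussianReal (μ := 0) (v := 1)
    rw [variance_of_integral_eq_zero (by fun_prop) (by simp)] at h
    simpa using h
  have hsqI : Integrable (fun z : ℝ => z ^ 2) (gaussianReal 0 1) :=
    (memLp_id_gaussianReal 2).integrable_sq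
  -- The integrand is even and `E Z² = 1`, so the half-line carries exactly half of the total mass
  -- 1. It minorizes the shifted density because `exp (-t(z-1)) ≥ 1 - t(z-1) ≥ 1 - t(z²-1)/2`.
  have hI : ∫ z in Set.Ioi 0, gaussianPDFReal 0 1 z * (1 - t * (z ^ 2 - 1) / 2) = 1 / 2 := by
    have h := integral_comp_abs (f := fun z => gaussianPDFReal 0 1 z * (1 - t * (z ^ 2 - 1) / 2))
    have h' : ∀ z : ℝ, gaussianPDFReal 0 1 |z| * (1 - t * (|z| ^ 2 - 1) / 2) =
        gaussianPDFReal 0 1 z * (1 - t * (z ^ 2 - 1) / 2) := by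
      intro z
      simp [gaussianPDFReal]
    simp_rw [h'] at h
    rw [hq] at h
    have h2 : ∫ z, (1 - t * (z ^ 2 - 1) / 2) ∂gaussianReal 0 1 = 1 := by
      have : (fun z : ℝ => 1 - t * (z ^ 2 - 1) / 2) = fun z => (1 + t / 2) - t / 2 * z ^ 2 := by
        ext z; ring
      rw [this, integral_sub (by fun_prop) (hsqI.const_mul _), integral_const_mul, hsq]
      simp
    linarith
  have hpI : Integrable (fun z => gaussianPDFReal 0 1 z * (1 - t * (z ^ 2 - 1) / 2)) := by
    by_contra hn
    have h0 : (fun z => gaussianPDFReal 0 1 z * (1 - t * (z ^ 2 - 1) / 2)) =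
        fun z => (1 + t / 2) * gaussianPDFReal 0 1 z - t / 2 * (gaussianPDFReal 0 1 z * z ^ 2) := by
      ext z; ring
    apply hn
    rw [h0]
    refine ((integrable_gaussianPDFReal 0 1).const_mul _).sub (Integrable.const_mul ?_ _)
    by_contra hc
    have := hq (fun z => z ^ 2)
    rw [integral_undef hc, hsq] at this
    norm_num at this
  rw [hmap, measureReal_def, gaussianReal_apply_eq_integral _ one_ne_zero,
    ENNReal.toReal_ofReal (setIntegral_nonneg measurableSet_Ioi
      fun z _ => gaussianPDFReal_nonneg _ _ _), ← hI, mul_comm, ← integral_const_mul]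
  refine setIntegral_mono_on (hpI.const_mul _).integrableOn
    (integrable_gaussianPDFReal _ _).integrableOn measurableSet_Ioi fun z hz => ?_
  have hz0 : (0 : ℝ) < z := hz
  have hpdf : gaussianPDFReal (-t) 1 z =
      gaussianPDFReal 0 1 z * Real.exp (-(t ^ 2 / 2 + t * z)) := by
    simp only [gaussianPDFReal, NNReal.coe_one, mul_one, sub_zero]
    rw [mul_assoc, ← Real.exp_add]
    congr 2; ring
  rw [hpdf, mul_left_comm]
  refine mul_le_mul_of_nonneg_left ?_ (gaussianPDFReal_nonneg _ _ _)
  rw [show -(t ^ 2 / 2 + t * z) = -(t ^ 2 / 2 + t) + -(t * (z - 1)) by ring, Real.exp_add]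
  refine mul_le_mul_of_nonneg_left ?_ (Real.exp_pos _).le
  have h1 := Real.add_one_le_exp (-(t * (z - 1)))
  nlinarith [mul_nonneg ht (sq_nonneg (z - 1))]

/-- A lower bound for the probability that a standard Gaussian vector is closer to `u` than to
the origin. -/
def flipBound (t : ℝ) : ℝ := 1 / 2 * Real.exp (-(t ^ 2 / 2 + t))

lemma flipBound_anti {s t : ℝ} (hs : 0 ≤ s) (h : s ≤ t) : flipBound t ≤ flipBound s := by
  unfold flipBound; gcongr

/-- Since `⟪u, e⟫` has law `N(0, ‖u‖²)`, this is the one-dimensional tail at `‖u‖ / 2`. -/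
lemma stdGaussian_halfspace_ge {m : ℕ} {u : E m} (hu : u ≠ 0) :
    flipBound (‖u‖ / 2) ≤ (stdGaussian (E m)).real {e | ‖u‖ ^ 2 / 2 < ⟪u, e⟫} := by
  have hu0 : 0 < ‖u‖ := norm_pos_iff.2 hu
  have h1 : (stdGaussian (E m)).real {e | ‖u‖ ^ 2 / 2 < ⟪u, e⟫} =
      (gaussianReal 0 (‖u‖ ^ 2).toNNReal).real (Set.Ioi (‖u‖ ^ 2 / 2)) := by
    rw [← stdGaussian_map_inner, measureReal_def, measureReal_def,
      Measure.map_apply (by fun_prop) measurableSet_Ioi]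
    rfl
  have h2 : gaussianReal 0 (‖u‖ ^ 2).toNNReal = (gaussianReal 0 1).map (‖u‖ * ·) := by
    rw [gaussianReal_map_const_mul]
    congr 1
    · simp
    · ext; simp
  rw [h1, h2, measureReal_def, Measure.map_apply (by fun_prop) measurableSet_Ioi]
  have h3 : (fun z => ‖u‖ * z) ⁻¹' Set.Ioi (‖u‖ ^ 2 / 2) = Set.Ioi (‖u‖ / 2) := by
    ext z
    simp only [Set.mem_preimage, Set.mem_Ioi]
    rw [show ‖u‖ ^ 2 / 2 = ‖u‖ * (‖u‖ / 2) by ring, mul_lt_mul_iff_right₀ hu0]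
  rw [h3]
  exact gaussianReal_Ioi_ge (by positivity)

lemma integral_inner_sq_stdGaussian {d : ℕ} (u : E d) :
    ∫ x, ⟪u, x⟫ ^ 2 ∂stdGaussian (E d) = ‖u‖ ^ 2 := by
  have h := variance_dual_stdGaussian (innerSL ℝ u)
  rw [variance_of_integral_eq_zero (by fun_prop) (integral_strongDual_stdGaussian _),
    innerSL_apply_norm] at h
  exact h

lemma integrable_inner_sq_stdGaussian {d : ℕ} (u : E d) :
    Integrable (fun x => ⟪u, x⟫ ^ 2) (stdGaussian (E d)) := by
  rcases eq_or_ne u 0 with rfl | hu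
  · simp
  by_contra hn
  have h := integral_inner_sq_stdGaussian u
  rw [integral_undef hn] at h
  exact hu (by simpa using h.symm)

lemma stdGaussian_inner_eq_null {d : ℕ} {u : E d} (hu : u ≠ 0) (r : ℝ) :
    stdGaussian (E d) {x | ⟪u, x⟫ = r} = 0 := by
  have h : (‖u‖ ^ 2).toNNReal ≠ 0 := by
    have : 0 < ‖u‖ := norm_pos_iff.2 hu
    simp [this.ne']
  have := nullSingletonClass_gaussianReal (μ := 0) h
  have h1 := measure_singleton (μ := gaussianReal 0 (‖u‖ ^ 2).toNNReal) r
  rwa [← stdGaussian_map_inner, Measure.map_apply (by fun_prop) (measurableSet_singleton r)] at h1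

/-! ### Linear predictors, matrix norms and second moments. -/

section linPred

variable {d m : ℕ} (B C : Matrix (Fin d) (Fin m) ℝ)

lemma linPred_sub (x x' : E d) : linPred B (x - x') = linPred B x - linPred B x' := by
  simp [linPred, Matrix.mulVec_sub]

lemma linPred_sub_left (x : E d) : linPred (B - C) x = linPred B x - linPred C x := by
  simp [linPred, Matrix.sub_mulVec]

@[fun_prop]
lemma continuous_linPred : Continuous (linPred B) := by
  unfold linPred
  fun_prop

@[fun_prop]
lemma measurable_linPred : Measurable (linPred B) := (continuous_linPred B).measurable

/-- The `l`-th column of a matrix. -/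
def colVec (l : Fin m) : E d := WithLp.toLp 2 fun k => B k l

lemma linPred_apply (x : E d) (l : Fin m) : linPred B x l = ⟪colVec B l, x⟫ := by
  simp [linPred, colVec, Matrix.mulVec, dotProduct, PiLp.inner_apply, mul_comm]

open scoped Matrix.Norms.L2Operator in
lemma specNorm_nonneg : 0 ≤ specNorm B := norm_nonneg B

open scoped Matrix.Norms.L2Operator in
lemma norm_linPred_le (x : E d) : ‖linPred B x‖ ≤ specNorm B * ‖x‖ := by
  have h := Matrix.l2_opNorm_mulVec B.conjTranspose x
  rw [Matrix.l2_opNorm_conjTranspose] at h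
  rwa [Matrix.conjTranspose_eq_transpose_of_trivial] at h

variable {B}

lemma frobSq_pos (hB : B ≠ 0) : 0 < frobSq B := by
  obtain ⟨k, l, h⟩ : ∃ k l, B k l ≠ 0 := by
    by_contra! h
    exact hB (Matrix.ext h)
  unfold frobSq
  refine Finset.sum_pos' (fun _ _ => Finset.sum_nonneg fun _ _ => sq_nonneg _)
    ⟨k, Finset.mem_univ _, Finset.sum_pos' (fun _ _ => sq_nonneg _)
      ⟨l, Finset.mem_univ _, by positivity⟩⟩

lemma responseDim_pos (hB : B ≠ 0) : 0 < m := by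
  rcases m with _ | m
  · exact absurd (Matrix.ext fun _ l => l.elim0) hB
  · omega

lemma exists_colVec_ne_zero (hB : B ≠ 0) : ∃ l, colVec B l ≠ 0 := by
  by_contra! h
  refine hB (Matrix.ext fun k l => ?_)
  simpa [colVec] using congrArg (fun v : E d => v k) (h l)

lemma frobSq_eq_sum_colVec : frobSq B = ∑ l, ‖colVec B l‖ ^ 2 := by
  simp only [frobSq, colVec, EuclideanSpace.real_norm_sq_eq]
  exact Finset.sum_comm

lemma norm_linPred_sq (x : E d) : ‖linPred B x‖ ^ 2 = ∑ l, ⟪colVec B l, x⟫ ^ 2 := by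
  simp [EuclideanSpace.real_norm_sq_eq, linPred_apply]

lemma integrable_norm_linPred_sq :
    Integrable (fun x => ‖linPred B x‖ ^ 2) (stdGaussian (E d)) := by
  simp_rw [norm_linPred_sq]
  exact integrable_finsetSum _ fun l _ => integrable_inner_sq_stdGaussian _

lemma integral_norm_linPred_sq :
    ∫ x, ‖linPred B x‖ ^ 2 ∂stdGaussian (E d) = frobSq B := by
  simp_rw [norm_linPred_sq]
  rw [integral_finsetSum _ fun l _ => integrable_inner_sq_stdGaussian _, frobSq_eq_sum_colVec]
  simp_rw [integral_inner_sq_stdGaussian]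

end linPred

/-! ### Joint laws of predictors and errors. -/

section laws

variable {n d m : ℕ} {Ω : Type*} [MeasurableSpace Ω] {P : Measure Ω} [IsProbabilityMeasure P]

/-- The law of `k` independent standard Gaussian vectors. -/
abbrev gaussFamily (n k : ℕ) : Measure (Fin n → E k) := Measure.pi fun _ => stdGaussian (E k)

lemma measurePreserving_family {z : Fin n → Ω → E d} (hz : ∀ i, Measurable (z i))
    (hl : ∀ i, P.map (z i) = stdGaussian (E d)) (hi : iIndepFun z P) :
    MeasurePreserving (fun ω i => z i ω) P (gaussFamily n d) := by
  refine ⟨measurable_pi_lambda _ hz, ?_⟩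
  rw [(iIndepFun_iff_map_fun_eq_pi_map fun i => (hz i).aemeasurable).1 hi]
  simp_rw [hl]

variable {θ : Fin n → Option (Fin n)} {B : Matrix (Fin d) (Fin m) ℝ} {σ : ℝ}
  {x : Fin n → Ω → E d} {y ε : Fin n → Ω → E m}

namespace IsLinkageModel

lemma measurePreserving_x (h : IsLinkageModel P θ B σ x y ε) :
    MeasurePreserving (fun ω i => x i ω) P (gaussFamily n d) :=
  measurePreserving_family h.measurable_x h.law_x h.indep_x

lemma measurePreserving_ε (h : IsLinkageModel P θ B σ x y ε) :
    MeasurePreserving (fun ω i => ε i ω) P (gaussFamily n m) :=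
  measurePreserving_family h.measurable_ε h.law_ε h.indep_ε

lemma measurePreserving_x_ε (h : IsLinkageModel P θ B σ x y ε) :
    MeasurePreserving (fun ω => ((fun i => x i ω), (fun i => ε i ω))) P
      ((gaussFamily n d).prod (gaussFamily n m)) := by
  have hx := h.measurePreserving_x
  have hε := h.measurePreserving_ε
  refine ⟨hx.measurable.prodMk hε.measurable, ?_⟩
  rw [(indepFun_iff_map_prod_eq_prod_map_map hx.measurable.aemeasurable
    hε.measurable.aemeasurable).1 h.indep_x_ε, hx.map_eq, hε.map_eq]

end IsLinkageModel

/-- Distinct predictors almost surely have distinct linear predictors. -/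
lemma gaussFamily_linPred_sub_ne_zero (n : ℕ) (hB : B ≠ 0) :
    ∀ᵐ x ∂gaussFamily n d, ∀ i j, i ≠ j → linPred B (x i - x j) ≠ 0 := by
  -- One nonzero column suffices: coinciding linear predictors have equal `l`-th coordinates, a null
  -- event by Fubini because a nondegenerate Gaussian has no atoms.
  obtain ⟨l, hl⟩ := exists_colVec_ne_zero hB
  rw [ae_all_iff]; intro i
  rw [ae_all_iff]; intro j
  rw [Filter.eventually_imp_distrib_left]
  intro hij
  have hind : IndepFun (fun x : Fin n → E d => x j) (fun x => x i) (gaussFamily n d) :=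
    (iIndepFun_pi (X := fun _ => id) (μ := fun _ : Fin n => stdGaussian (E d))
      (fun i => aemeasurable_id)).indepFun hij.symm
  have hmap := (indepFun_iff_map_prod_eq_prod_map_map (measurable_pi_apply j).aemeasurable
    (measurable_pi_apply i).aemeasurable).1 hind
  have hmap_i : (gaussFamily n d).map (fun x => x i) = stdGaussian (E d) :=
    (measurePreserving_eval (fun _ : Fin n => stdGaussian (E d)) i).map_eq
  have hmap_j : (gaussFamily n d).map (fun x => x j) = stdGaussian (E d) :=
    (measurePreserving_eval (fun _ : Fin n => stdGaussian (E d)) j).map_eq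
  rw [hmap_i, hmap_j] at hmap
  have hS : MeasurableSet {p : E d × E d | ⟪colVec B l, p.2⟫ = ⟪colVec B l, p.1⟫} :=
    measurableSet_eq_fun (by fun_prop) (by fun_prop)
  have hnull : ((stdGaussian (E d)).prod (stdGaussian (E d)))
      {p : E d × E d | ⟪colVec B l, p.2⟫ = ⟪colVec B l, p.1⟫} = 0 := by
    rw [Measure.measure_prod_null hS]
    filter_upwards with a
    exact stdGaussian_inner_eq_null hl ⟪colVec B l, a⟫
  rw [← hmap, Measure.map_apply (by fun_prop) hS] at hnull
  rw [ae_iff]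
  refine measure_mono_null (fun x hx => ?_) hnull
  simp only [ne_eq, not_not, Set.mem_ofPred_eq] at hx
  simp only [Set.mem_preimage, Set.mem_ofPred_eq]
  have := congrArg (fun v : E m => v l) hx
  simp only [linPred_apply, inner_sub_right] at this
  simpa [sub_eq_zero] using this

end laws

/-! ### Exact matching on a good sample. -/

section deterministic

variable {n d m : ℕ} {θ : Fin n → Option (Fin n)} {B C : Matrix (Fin d) (Fin m) ℝ} {σ τ : ℝ}
  {x : Fin n → E d} {y ε : Fin n → E m} {jhat : Fin n → Fin n}

lemma div_frobSq_mul_SNR (hB : B ≠ 0) (a : ℝ) : a / frobSq B * SNR B σ = a / (σ ^ 2 * m) := by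
  have := frobSq_pos hB
  unfold SNR
  field_simp

lemma norm_linPred_sub_comm (x x' : E d) : ‖linPred B (x - x')‖ = ‖linPred B (x' - x)‖ := by
  rw [linPred_sub, linPred_sub, norm_sub_rev]

lemma gammaSq_le {i j : Fin n} (hij : i ≠ j) :
    gammaSq B x ≤ ENNReal.ofReal (‖linPred B (x i - x j)‖ ^ 2 / frobSq B) := by
  rcases hij.lt_or_gt with h | h
  · exact iInf_le_of_le i (iInf_le_of_le j (iInf_le _ h))
  · rw [norm_linPred_sub_comm]
    exact iInf_le_of_le j (iInf_le_of_le i (iInf_le _ h))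

lemma separation_le_pair (hB : B ≠ 0) {i j : Fin n} (hij : i ≠ j) :
    separation θ B σ x y ≤ ENNReal.ofReal (‖linPred B (x i - x j)‖ ^ 2 / (σ ^ 2 * m)) := by
  rw [← div_frobSq_mul_SNR hB, ENNReal.ofReal_mul (by have := frobSq_pos hB; positivity)]
  exact mul_le_mul_left ((min_le_right _ _).trans (gammaSq_le hij)) _

lemma separation_le_unmatched (hB : B ≠ 0) {i : Fin n} (hi : θ i = none) (j : Fin n) :
    separation θ B σ x y ≤ ENNReal.ofReal (‖y i - linPred B (x j)‖ ^ 2 / (σ ^ 2 * m)) := by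
  rw [← div_frobSq_mul_SNR hB, ENNReal.ofReal_mul (by have := frobSq_pos hB; positivity)]
  exact mul_le_mul_left ((min_le_left _ _).trans
    (iInf_le_of_le i (iInf_le_of_le hi (iInf_le _ j)))) _

/-- The entry `τ² / (σ² m)` of the maximum is enough: the factor 36 becomes 6 after taking roots. -/
lemma WellSeparated.lt_norm (h : WellSeparated θ B C σ τ x y) (hB : B ≠ 0) (hσ : 0 < σ)
    {v : E m} (hv : separation θ B σ x y ≤ ENNReal.ofReal (‖v‖ ^ 2 / (σ ^ 2 * m))) :
    6 * τ < ‖v‖ := by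
  have hm : (0 : ℝ) < m := by exact_mod_cast responseDim_pos hB
  have h1 := lt_of_lt_of_le h hv
  have h2 := (ENNReal.ofReal_lt_ofReal_iff_of_nonneg (by positivity)).1 h1
  have h3 : 36 * (τ ^ 2 / (σ ^ 2 * m)) < ‖v‖ ^ 2 / (σ ^ 2 * m) :=
    lt_of_le_of_lt (mul_le_mul_of_nonneg_left ((le_max_right _ _).trans (le_max_right _ _))
      (by norm_num)) h2
  rw [← mul_div_assoc, div_lt_div_iff_of_pos_right (by positivity)] at h3
  refine lt_of_pow_lt_pow_left₀ 2 (norm_nonneg _) ?_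
  linarith [mul_pow 6 τ 2]

/-- On a well separated sample with small errors, the thresholded matching is exact. -/
lemma matchingEstimator_eq_of_wellSeparated (hB : B ≠ 0) (hσ : 0 < σ)
    (hmatch : ∀ i j, θ i = some j → y i = linPred B (x j) + σ • ε i)
    (hε : ∀ i, ‖ε i‖ ≤ √m + 2 * √(Real.log n)) (hτ : tauZero B C σ x < τ)
    (hsep : WellSeparated θ B C σ τ x y) (hj : IsNearest C x y jhat) :
    matchingEstimator C x y τ jhat = matchingMatrix θ := by
  have hK : ∀ j, ‖linPred B (x j) - linPred C (x j)‖ ≤ (⨆ j, ‖x j‖) * specNorm (B - C) := by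
    intro j
    rw [← linPred_sub_left, mul_comm]
    exact (norm_linPred_le _ _).trans (mul_le_mul_of_nonneg_left
      (le_ciSup (f := fun j => ‖x j‖) (Set.finite_range _).bddAbove j) (specNorm_nonneg _))
  have hK0 : 0 ≤ (⨆ j, ‖x j‖) * specNorm (B - C) :=
    mul_nonneg (Real.iSup_nonneg fun _ => norm_nonneg _) (specNorm_nonneg _)
  have hE : ∀ i, ‖σ • ε i‖ ≤ σ * (√m + 2 * √(Real.log n)) := by
    intro i
    rw [norm_smul, Real.norm_eq_abs, abs_of_pos hσ]
    exact mul_le_mul_of_nonneg_left (hε i) hσ.le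
  unfold tauZero at hτ
  have hR0 : 0 ≤ σ * (√m + 2 * √(Real.log n)) := by positivity
  -- Call the two summands of `τ₀` `R` (errors) and `K` (estimation of `B`), so `R + K < τ`. A true
  -- match is within `R + K`; the next two claims leave a wrong candidate at distance more than `6τ
  -- - (R + K) > 5τ`.
  have htrue : ∀ i j, θ i = some j → ‖y i - linPred C (x j)‖ < τ := by
    intro i j hij
    rw [hmatch i j hij]
    calc _ = ‖(linPred B (x j) - linPred C (x j)) + σ • ε i‖ := by congr 1; abel
      _ ≤ _ := norm_add_le _ _
      _ < τ := by linarith [hK j, hE i]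
  have hfalse : ∀ i j k, θ i = some j → k ≠ j → τ < ‖y i - linPred C (x k)‖ := by
    intro i j k hij hkj
    have h1 := hsep.lt_norm hB hσ (separation_le_pair hB hkj)
    have h2 : linPred B (x k - x j) = -(y i - linPred C (x k)) + σ • ε i +
        (linPred B (x k) - linPred C (x k)) := by
      rw [hmatch i j hij, linPred_sub]; abel
    have h3 := norm_add₃_le (a := -(y i - linPred C (x k))) (b := σ • ε i)
      (c := linPred B (x k) - linPred C (x k))
    rw [← h2, norm_neg] at h3
    linarith [hK k, hE i]
  have hnone : ∀ i k, θ i = none → τ < ‖y i - linPred C (x k)‖ := by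
    intro i k hi
    have h1 := hsep.lt_norm hB hσ (separation_le_unmatched hB hi k)
    have h3 := norm_add_le (y i - linPred C (x k)) (-(linPred B (x k) - linPred C (x k)))
    rw [norm_neg, show y i - linPred C (x k) + -(linPred B (x k) - linPred C (x k)) =
      y i - linPred B (x k) by abel] at h3
    linarith [hK k]
  ext i j
  simp only [matchingEstimator, matchingMatrix, Matrix.of_apply]
  congr 1
  rw [eq_iff_iff]
  constructor
  · rintro ⟨rfl, hle⟩
    rcases hi : θ i with _ | k
    · exact absurd hle (hnone i _ hi).not_ge
    · by_contra hne
      exact absurd hle (hfalse i k _ hi fun h => hne (by rw [h])).not_ge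
  · intro hi
    have : jhat i = j := by
      by_contra hne
      exact absurd (hj i j) ((htrue i j hi).trans (hfalse i j _ hi hne)).not_ge
    subst this
    exact ⟨rfl, (htrue i _ hi).le⟩

end deterministic

/-! ### Probability of exact recovery. -/

section achievability

variable {n d m : ℕ} {Ω : Type*} [MeasurableSpace Ω] {P : Measure Ω} [IsProbabilityMeasure P]
  {θ : Fin n → Option (Fin n)} {B : Matrix (Fin d) (Fin m) ℝ} {σ : ℝ}
  {x : Fin n → Ω → E d} {y ε : Fin n → Ω → E m}

/-- The tail bound at `t = 2√(log n)` equals `n⁻²`, and a union over `n` errors costs a factor `n`.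
-/
lemma IsLinkageModel.large_error_le (h : IsLinkageModel P θ B σ x y ε) (hn : 0 < n)
    (hm : 0 < m) : P.real {ω | ∃ i, √m + 2 * √(Real.log n) < ‖ε i ω‖} ≤ 1 / n := by
  have hn' : (0 : ℝ) < n := by exact_mod_cast hn
  have hlog : 0 ≤ Real.log n := Real.log_natCast_nonneg n
  have h1 : ∀ i, P.real {ω | √m + 2 * √(Real.log n) < ‖ε i ω‖} ≤ ((n : ℝ) ^ 2)⁻¹ := by
    intro i
    have hb := stdGaussian_norm_tail hm (t := 2 * √(Real.log n)) (by positivity)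
    have he : Real.exp (-(2 * √(Real.log n)) ^ 2 / 2) = ((n : ℝ) ^ 2)⁻¹ := by
      rw [mul_pow, Real.sq_sqrt hlog,
        show -(2 ^ 2 * Real.log n) / 2 = -(Real.log n * (2 : ℕ)) by push_cast; ring, Real.exp_neg,
        mul_comm, Real.exp_nat_mul, Real.exp_log hn']
    rw [he, ← h.law_ε i, map_measureReal_apply (h.measurable_ε i)
      (measurableSet_le measurable_const measurable_norm)] at hb
    refine le_trans (measureReal_mono fun ω hω => ?_) hb
    exact le_of_lt (Set.mem_ofPred_eq ▸ hω)
  rw [show {ω | ∃ i, √m + 2 * √(Real.log n) < ‖ε i ω‖} =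
    ⋃ i, {ω | √m + 2 * √(Real.log n) < ‖ε i ω‖} by ext; simp]
  refine (measureReal_iUnion_fintype_le _).trans ((Finset.sum_le_sum fun i _ => h1 i).trans ?_)
  simp only [Finset.sum_const, Finset.card_univ, Fintype.card_fin, nsmul_eq_mul]
  apply le_of_eq
  field_simp

lemma IsLinkageModel.achievability (h : IsLinkageModel P θ B σ x y ε)
    {C : Ω → Matrix (Fin d) (Fin m) ℝ} {τ : Ω → ℝ} {jhat : Ω → Fin n → Fin n}
    (hn : 0 < n) (hB : B ≠ 0) (hσ : 0 < σ)
    (hτ : ∀ᵐ ω ∂P, tauZero B (C ω) σ (x · ω) < τ ω)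
    (hj : ∀ ω, IsNearest (C ω) (x · ω) (y · ω) (jhat ω)) :
    1 - P.real (goodEvent θ B C σ τ x y)ᶜ - 1 / n ≤
      P.real (goodEvent θ B C σ τ x y ∩ recoveryEvent θ C τ jhat x y) := by
  set G := goodEvent θ B C σ τ x y
  set R := recoveryEvent θ C τ jhat x y
  set A := {ω | ∃ i, √m + 2 * √(Real.log n) < ‖ε i ω‖}
  have hA : P.real A ≤ 1 / n := h.large_error_le hn (responseDim_pos hB)
  -- A cover of almost all of `Ω`; subadditivity then needs no measurability of the events.
  have hsub : ∀ᵐ ω ∂P, ω ∈ (G ∩ R) ∪ (Gᶜ ∪ A) := by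
    filter_upwards [hτ] with ω hω
    by_cases hG : ω ∈ G
    · by_cases hA' : ω ∈ A
      · exact Or.inr (Or.inr hA')
      · refine Or.inl ⟨hG, ?_⟩
        refine matchingEstimator_eq_of_wellSeparated (ε := (ε · ω)) hB hσ
          (fun i j hij => h.matched i j hij ω) (fun i => ?_) hω hG (hj ω)
        by_contra hlt
        exact hA' ⟨i, not_le.1 hlt⟩
    · exact Or.inr (Or.inl hG)
  have h1 : P.real ((G ∩ R) ∪ (Gᶜ ∪ A)) = 1 := by
    have h0 : ((G ∩ R) ∪ (Gᶜ ∪ A) : Set Ω) =ᵐ[P] Set.univ := Filter.eventuallyEq_univ.2 hsub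
    rw [measureReal_congr h0, probReal_univ]
  have h2 := measureReal_union_le (μ := P) (G ∩ R) (Gᶜ ∪ A)
  have h3 := measureReal_union_le (μ := P) Gᶜ A
  linarith

/-- Conditioning on a non-null event does not decrease the probability of its intersections. -/
lemma measureReal_inter_le_cond {s : Set Ω} (hs : P s ≠ 0) (t : Set Ω) :
    P.real (s ∩ t) ≤ (ProbabilityTheory.cond P s).real t := by
  have := cond_isProbabilityMeasure hs
  refine ENNReal.toReal_mono (measure_ne_top _ _) ?_
  rw [ProbabilityTheory.cond, Measure.smul_apply, smul_eq_mul]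
  calc P (s ∩ t) = 1 * P (t ∩ s) := by rw [one_mul, Set.inter_comm]
    _ ≤ (P s)⁻¹ * P.restrict s t :=
      mul_le_mul' (ENNReal.one_le_inv.2 prob_le_one) (Measure.le_restrict_apply _ _)

end achievability

/-! ### Flips: a response nearer to a wrong linear predictor. -/

section flip

variable {n d m : ℕ} {θ : Fin n → Option (Fin n)} {B : Matrix (Fin d) (Fin m) ℝ} {σ : ℝ}

/-- The difference of the `k`-th and the `j`-th linear predictor in units of the noise level. -/
def flipVec (B : Matrix (Fin d) (Fin m) ℝ) (σ : ℝ) (x : Fin n → E d) (j k : Fin n) : E m :=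
  σ⁻¹ • linPred B (x k - x j)

lemma norm_flipVec (hσ : 0 < σ) (x : Fin n → E d) (j k : Fin n) :
    ‖flipVec B σ x j k‖ = ‖linPred B (x k - x j)‖ / σ := by
  rw [flipVec, norm_smul, norm_inv, Real.norm_eq_abs, abs_of_pos hσ, div_eq_inv_mul]

lemma flipVec_ne_zero (hσ : 0 < σ) {x : Fin n → E d} {j k : Fin n}
    (h : linPred B (x k - x j) ≠ 0) : flipVec B σ x j k ≠ 0 :=
  smul_ne_zero (inv_ne_zero hσ.ne') h

@[fun_prop]
lemma measurable_flipVec (j k : Fin n) :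
    Measurable fun x : Fin n → E d => flipVec B σ x j k := by
  unfold flipVec
  have h : Measurable fun x : Fin n → E d => x k - x j := by fun_prop
  exact Measurable.const_smul ((measurable_linPred B).comp h) σ⁻¹

/-- The data for which the response `i`, generated by the predictor `j`, is strictly closer to the
linear predictor `k` than to the linear predictor `j`. -/
def flipSet (B : Matrix (Fin d) (Fin m) ℝ) (σ : ℝ) (i j k : Fin n) :
    Set ((Fin n → E d) × (Fin n → E m)) :=
  {p | ‖flipVec B σ p.1 j k‖ ^ 2 / 2 < ⟪flipVec B σ p.1 j k, p.2 i⟫}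

lemma measurableSet_flipSet (i j k : Fin n) : MeasurableSet (flipSet B σ i j k) := by
  have h : Measurable fun p : (Fin n → E d) × (Fin n → E m) => flipVec B σ p.1 j k :=
    (measurable_flipVec j k).comp measurable_fst
  exact measurableSet_lt (by fun_prop) (h.inner ((measurable_pi_apply i).comp measurable_snd))

/-- Recovery forces `jhat i = j` for every threshold, since thresholding can only delete ones.
Minimality then reads `‖ε‖ ≤ ‖ε - w‖` after division by `σ`, and expanding the square gives the
half-space. -/
lemma notMem_flipSet_of_recovery {x : Fin n → E d} {y ε : Fin n → E m} {τ : ℝ}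
    {jhat : Fin n → Fin n} (hσ : 0 < σ)
    (hmatch : ∀ i j, θ i = some j → y i = linPred B (x j) + σ • ε i)
    (hj : IsNearest B x y jhat) (hrec : matchingEstimator B x y τ jhat = matchingMatrix θ)
    {i j : Fin n} (hij : θ i = some j) (k : Fin n) : (x, ε) ∉ flipSet B σ i j k := by
  have h1 : jhat i = j := by
    have h := congrFun (congrFun hrec i) j
    simp only [matchingEstimator, matchingMatrix, Matrix.of_apply, hij, if_true] at h
    by_contra hne
    rw [if_neg fun hc => hne hc.1.symm] at h
    exact zero_ne_one h
  have h2 := hj i k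
  have hw : linPred B (x k - x j) = σ • flipVec B σ x j k := by
    rw [flipVec, smul_inv_smul₀ hσ.ne']
  rw [h1, hmatch i j hij, add_sub_cancel_left, show linPred B (x j) + σ • ε i - linPred B (x k) =
    σ • (ε i - flipVec B σ x j k) by rw [smul_sub, ← hw, linPred_sub]; abel, norm_smul, norm_smul,
    mul_le_mul_iff_right₀ (by simpa using hσ.ne')] at h2
  have h3 : ‖ε i‖ ^ 2 ≤ ‖ε i - flipVec B σ x j k‖ ^ 2 := by gcongr
  rw [norm_sub_sq_real, real_inner_comm] at h3
  simp only [flipSet, Set.mem_ofPred_eq, not_lt]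
  linarith

lemma gaussFamily_halfspace_ge {u : E m} (hu : u ≠ 0) (i : Fin n) :
    flipBound (‖u‖ / 2) ≤ (gaussFamily n m).real {e | ‖u‖ ^ 2 / 2 < ⟪u, e i⟫} := by
  refine (stdGaussian_halfspace_ge hu).trans_eq ?_
  have h := (measurePreserving_eval (fun _ : Fin n => stdGaussian (E m)) i).measureReal_preimage
    (s := {e | ‖u‖ ^ 2 / 2 < ⟪u, e⟫})
    (measurableSet_lt (by fun_prop) (by fun_prop)).nullMeasurableSet
  exact h.symm

/-- Independence turns the probability into a product, and each factor is `1 - p ≤ exp (-p)`. -/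
lemma gaussFamily_forall_halfspace_le {u : Fin n → E m} (hu : ∀ i, u i ≠ 0) :
    gaussFamily n m {e | ∀ i, ⟪u i, e i⟫ ≤ ‖u i‖ ^ 2 / 2} ≤
      ENNReal.ofReal (Real.exp (-∑ i, flipBound (‖u i‖ / 2))) := by
  have hset : {e : Fin n → E m | ∀ i, ⟪u i, e i⟫ ≤ ‖u i‖ ^ 2 / 2} =
      Set.univ.pi fun i => {e | ⟪u i, e⟫ ≤ ‖u i‖ ^ 2 / 2} := by
    ext e; simp
  rw [hset, Measure.pi_pi, ← Finset.sum_neg_distrib, Real.exp_sum,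
    ENNReal.ofReal_prod_of_nonneg fun _ _ => (Real.exp_pos _).le]
  refine Finset.prod_le_prod' fun i _ => ?_
  rw [ENNReal.le_ofReal_iff_toReal_le (measure_ne_top _ _) (Real.exp_pos _).le]
  have hc : {e : E m | ⟪u i, e⟫ ≤ ‖u i‖ ^ 2 / 2} = {e | ‖u i‖ ^ 2 / 2 < ⟪u i, e⟫}ᶜ := by
    ext e; simp
  have h1 : (stdGaussian (E m)).real {e | ⟪u i, e⟫ ≤ ‖u i‖ ^ 2 / 2} =
      1 - (stdGaussian (E m)).real {e | ‖u i‖ ^ 2 / 2 < ⟪u i, e⟫} := by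
    rw [hc, probReal_compl_eq_one_sub (measurableSet_lt (by fun_prop) (by fun_prop))]
  change (stdGaussian (E m)).real _ ≤ _
  rw [h1]
  linarith [stdGaussian_halfspace_ge (hu i), Real.add_one_le_exp (-flipBound (‖u i‖ / 2))]

lemma exp_neg_sum_flipBound_le (hn : 2 ≤ n) {t : Fin n → ℝ}
    (ht : ∑ i, t i ^ 2 ≤ n * Real.log n / 110) :
    Real.exp (-∑ i, flipBound (t i)) ≤ 5 / 12 := by
  have hn0 : (0 : ℝ) < n := by positivity
  have hlog : Real.log 2 ≤ Real.log n := Real.log_le_log (by norm_num) (by exact_mod_cast hn)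
  -- As `t ≤ 5t² + 1/20`, the exponent in `flipBound` is at most `1/20 + (11/2) t²`, whose average
  -- over `i` is at most `w`. Using the tangent of `exp` at `-w` gives Jensen's inequality by hand.
  obtain ⟨w, hw⟩ : ∃ w : ℝ, w = 1 / 20 + Real.log n / 20 := ⟨_, rfl⟩
  have hone : ∀ i, 1 / 2 * (Real.exp (-w) * (1 + w - (1 / 20 + 11 / 2 * t i ^ 2))) ≤
      flipBound (t i) := by
    intro i
    unfold flipBound
    refine mul_le_mul_of_nonneg_left ?_ (by norm_num)
    rw [show -(t i ^ 2 / 2 + t i) = -w + (w - (t i ^ 2 / 2 + t i)) by ring, Real.exp_add]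
    refine mul_le_mul_of_nonneg_left ?_ (Real.exp_pos _).le
    nlinarith [Real.add_one_le_exp (w - (t i ^ 2 / 2 + t i)), sq_nonneg (10 * t i - 1)]
  have hsum : 1 / 2 * (n * Real.exp (-w)) ≤ ∑ i, flipBound (t i) := by
    refine le_trans ?_ (Finset.sum_le_sum fun i _ => hone i)
    rw [← Finset.mul_sum, ← Finset.mul_sum, Finset.sum_sub_distrib, Finset.sum_add_distrib,
      Finset.sum_add_distrib, ← Finset.mul_sum]
    simp only [Finset.sum_const, Finset.card_univ, Fintype.card_fin, nsmul_eq_mul]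
    rw [mul_comm (n : ℝ) (Real.exp (-w))]
    gcongr
    rw [hw]
    linarith
  -- Here `log n - w = (19/20) log n - 1/20`, smallest at `n = 2`, where it is about 0.608.
  have hexp : Real.exp (3 / 5) ≤ n * Real.exp (-w) := by
    rw [show (n : ℝ) * Real.exp (-w) = Real.exp (Real.log n - w) by
      rw [sub_eq_add_neg, Real.exp_add, Real.exp_log hn0]]
    apply Real.exp_le_exp.2
    rw [hw]
    linarith [Real.log_two_gt_d9]
  have hnum : 1.82 ≤ Real.exp (3 / 5) := by
    have h := Real.sum_le_exp_of_nonneg (x := 3 / 5) (by norm_num) 5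
    norm_num [Finset.sum_range_succ, Nat.factorial] at h ⊢
    linarith
  have hnum2 : 12 / 5 ≤ Real.exp (0.91) := by
    have h := Real.sum_le_exp_of_nonneg (x := 0.91) (by norm_num) 4
    norm_num [Finset.sum_range_succ, Nat.factorial] at h ⊢
    linarith
  have h91 : (0.91 : ℝ) ≤ ∑ i, flipBound (t i) := by linarith
  rw [Real.exp_neg, show (5 / 12 : ℝ) = (12 / 5)⁻¹ by norm_num]
  exact inv_anti₀ (by norm_num) (hnum2.trans (Real.exp_le_exp.2 h91))

end flip

/-- Fubini, with sections over `A` bounded trivially by 1. -/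
lemma prod_le_add_of_ae_section_le {α β : Type*} [MeasurableSpace α] [MeasurableSpace β]
    {μ : Measure α} [IsProbabilityMeasure μ] {ν : Measure β} [IsProbabilityMeasure ν]
    {T : Set (α × β)} (hT : MeasurableSet T) {A : Set α} (hA : MeasurableSet A) {b : ℝ≥0∞}
    (h : ∀ᵐ a ∂μ, a ∉ A → ν (Prod.mk a ⁻¹' T) ≤ b) : μ.prod ν T ≤ μ A + b := by
  rw [Measure.prod_apply hT]
  calc ∫⁻ a, ν (Prod.mk a ⁻¹' T) ∂μ ≤ ∫⁻ a, (A.indicator 1 a + b) ∂μ := by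
        refine lintegral_mono_ae ?_
        filter_upwards [h] with a ha
        by_cases hm : a ∈ A
        · simpa [hm] using prob_le_one.trans le_self_add
        · simpa [hm] using ha hm
    _ = μ A + b := by
        rw [lintegral_add_right _ measurable_const, lintegral_indicator_one hA]
        simp

/-! ### Failure at low signal-to-noise ratio. -/

section converse

variable {n d m : ℕ} {Ω : Type*} [MeasurableSpace Ω] {P : Measure Ω} [IsProbabilityMeasure P]
  {θ : Fin n → Option (Fin n)} {B : Matrix (Fin d) (Fin m) ℝ} {σ : ℝ}
  {x : Fin n → Ω → E d} {y ε : Fin n → Ω → E m} {τ : Ω → ℝ} {jhat : Ω → Fin n → Fin n}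

lemma integrable_norm_linPred_apply_sq (j : Fin n) :
    Integrable (fun x => ‖linPred B (x j)‖ ^ 2) (gaussFamily n d) :=
  (measurePreserving_eval (fun _ : Fin n => stdGaussian (E d)) j).integrable_comp_of_integrable
    integrable_norm_linPred_sq

lemma integral_norm_linPred_apply_sq (j : Fin n) :
    ∫ x, ‖linPred B (x j)‖ ^ 2 ∂gaussFamily n d = frobSq B := by
  rw [← integral_norm_linPred_sq (B := B),
    ← (measurePreserving_eval (fun _ : Fin n => stdGaussian (E d)) j).map_eq,
    integral_map (measurable_pi_apply j).aemeasurable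
      (Measurable.aestronglyMeasurable (by fun_prop))]

lemma norm_flipVec_sq_le (hσ : 0 < σ) (x : Fin n → E d) (j k : Fin n) :
    (‖flipVec B σ x j k‖ / 2) ^ 2 ≤
      (‖linPred B (x k)‖ ^ 2 + ‖linPred B (x j)‖ ^ 2) / (2 * σ ^ 2) := by
  rw [norm_flipVec hσ, linPred_sub]
  have h := norm_sub_le (linPred B (x k)) (linPred B (x j))
  have h2 : ‖linPred B (x k) - linPred B (x j)‖ ^ 2 ≤
      2 * (‖linPred B (x k)‖ ^ 2 + ‖linPred B (x j)‖ ^ 2) := by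
    nlinarith [norm_nonneg (linPred B (x k) - linPred B (x j)),
      sq_nonneg (‖linPred B (x k)‖ - ‖linPred B (x j)‖)]
  rw [div_pow, div_pow, le_div_iff₀ (by positivity)]
  field_simp
  linarith

/-- Markov's inequality for a majorant from `‖a - b‖² ≤ 2(‖a‖² + ‖b‖²)`. Only expectations enter, so
`φ` and `κ` may repeat indices. -/
lemma gaussFamily_sum_flipVec_ge_le (hσ : 0 < σ) (φ κ : Fin n → Fin n) {T : ℝ} (hT : 0 < T) :
    (gaussFamily n d).real {x | T ≤ ∑ i, (‖flipVec B σ x (φ i) (κ i)‖ / 2) ^ 2} ≤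
      n * frobSq B / σ ^ 2 / T := by
  set S : (Fin n → E d) → ℝ := fun x =>
    ∑ i, (‖linPred B (x (κ i))‖ ^ 2 + ‖linPred B (x (φ i))‖ ^ 2) / (2 * σ ^ 2) with hS
  have hI : ∀ i, Integrable (fun x : Fin n → E d =>
      (‖linPred B (x (κ i))‖ ^ 2 + ‖linPred B (x (φ i))‖ ^ 2) / (2 * σ ^ 2)) (gaussFamily n d) :=
    fun i => ((integrable_norm_linPred_apply_sq _).add
      (integrable_norm_linPred_apply_sq _)).div_const _
  have hSI : Integrable S (gaussFamily n d) := integrable_finsetSum _ fun i _ => hI i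
  have hSE : ∫ x, S x ∂gaussFamily n d = n * frobSq B / σ ^ 2 := by
    rw [hS, integral_finsetSum _ fun i _ => hI i]
    simp_rw [integral_div, integral_add (integrable_norm_linPred_apply_sq (B := B) _)
      (integrable_norm_linPred_apply_sq (B := B) _), integral_norm_linPred_apply_sq]
    simp only [Finset.sum_const, Finset.card_univ, Fintype.card_fin, nsmul_eq_mul]
    field_simp
    ring
  have hM := mul_meas_ge_le_integral_of_nonneg (μ := gaussFamily n d) (f := S)
    (Filter.Eventually.of_forall fun x => Finset.sum_nonneg fun i _ => by positivity) hSI T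
  rw [le_div_iff₀ hT, mul_comm, ← hSE]
  refine le_trans (mul_le_mul_of_nonneg_left (measureReal_mono fun x hx => ?_) hT.le) hM
  exact le_trans hx (Finset.sum_le_sum fun i _ => norm_flipVec_sq_le hσ _ _ _)

lemma IsLinkageModel.recovery_le (h : IsLinkageModel P θ B σ x y ε) (hB : B ≠ 0) (hσ : 0 < σ)
    (hθ : ∀ i, θ i ≠ none) (hj : ∀ ω, IsNearest B (x · ω) (y · ω) (jhat ω))
    (hsnr : SNR B σ < 1 / 440 * (Real.log n / m)) :
    P.real (recoveryEvent θ (fun _ => B) τ jhat x y) ≤ 2 / 3 := by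
  have hm : (0 : ℝ) < m := by exact_mod_cast responseDim_pos hB
  have hfrob : frobSq B / σ ^ 2 < Real.log n / 440 := by
    unfold SNR at hsnr
    rw [← div_div, ← mul_div_assoc, div_lt_div_iff_of_pos_right hm] at hsnr
    linarith
  have hlog : 0 < Real.log n := by
    have : 0 < frobSq B / σ ^ 2 := div_pos (frobSq_pos hB) (by positivity)
    linarith
  have hn : 2 ≤ n := by
    by_contra hlt
    have : n = 0 ∨ n = 1 := by omega
    rcases this with rfl | rfl <;> simp at hlog
  have hn0 : (0 : ℝ) < n := by positivity
  have : Nontrivial (Fin n) := Fin.nontrivial_iff_two_le.2 hn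
  choose φ hφ using fun i => Option.ne_none_iff_exists'.1 (hθ i)
  choose κ hκ using fun i => exists_ne (φ i)
  set D : Set ((Fin n → E d) × (Fin n → E m)) := ⋂ i, (flipSet B σ i (φ i) (κ i))ᶜ
  have hD : MeasurableSet D := MeasurableSet.iInter fun i => (measurableSet_flipSet _ _ _).compl
  have hsub : recoveryEvent θ (fun _ => B) τ jhat x y ⊆
      (fun ω => ((fun i => x i ω), (fun i => ε i ω))) ⁻¹' D := by
    intro ω hω
    simp only [Set.mem_preimage, D, Set.mem_iInter, Set.mem_compl_iff]
    exact fun i => notMem_flipSet_of_recovery hσ (fun i j hij => h.matched i j hij ω) (hj ω) hω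
      (hφ i) _
  -- The constant 1/440 makes the mean in Markov's bound at most `T / 4`.
  set T : ℝ := n * Real.log n / 110
  have hT : 0 < T := by positivity
  set A : Set (Fin n → E d) := {x | T ≤ ∑ i, (‖flipVec B σ x (φ i) (κ i)‖ / 2) ^ 2}
  have hA : MeasurableSet A := measurableSet_le measurable_const (by fun_prop)
  have hAle : (gaussFamily n d).real A ≤ 1 / 4 := by
    refine (gaussFamily_sum_flipVec_ge_le hσ φ κ hT).trans ?_
    rw [div_le_iff₀ hT, mul_div_assoc]
    have := mul_le_mul_of_nonneg_left hfrob.le hn0.le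
    calc _ ≤ _ := this
      _ = _ := by simp only [T]; ring
  have hDle : (gaussFamily n d).prod (gaussFamily n m) D ≤
      gaussFamily n d A + ENNReal.ofReal (5 / 12) := by
    refine prod_le_add_of_ae_section_le hD hA ?_
    filter_upwards [gaussFamily_linPred_sub_ne_zero n hB] with x hx hxA
    have h1 := gaussFamily_forall_halfspace_le (n := n)
      (u := fun i => flipVec B σ x (φ i) (κ i)) fun i => flipVec_ne_zero hσ (hx _ _ (hκ i))
    have h2 : Prod.mk x ⁻¹' D = {e : Fin n → E m | ∀ i, ⟪flipVec B σ x (φ i) (κ i), e i⟫ ≤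
        ‖flipVec B σ x (φ i) (κ i)‖ ^ 2 / 2} := by
      ext e
      simp [D, flipSet]
    rw [h2]
    exact h1.trans (ENNReal.ofReal_le_ofReal (exp_neg_sum_flipBound_le hn (not_le.1 hxA).le))
  calc P.real (recoveryEvent θ (fun _ => B) τ jhat x y)
      ≤ P.real ((fun ω => ((fun i => x i ω), (fun i => ε i ω))) ⁻¹' D) := measureReal_mono hsub
    _ = ((gaussFamily n d).prod (gaussFamily n m)).real D :=
        h.measurePreserving_x_ε.measureReal_preimage hD.nullMeasurableSet
    _ ≤ (gaussFamily n d).real A + 5 / 12 := by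
        refine (ENNReal.toReal_mono (by finiteness) hDle).trans_eq ?_
        rw [ENNReal.toReal_add (by finiteness) (by finiteness),
          ENNReal.toReal_ofReal (by norm_num)]
        rfl
    _ ≤ 2 / 3 := by linarith

end converse

/-! ### Conditional probabilities given the predictors. -/

section conditional

variable {Ω α β : Type*} [MeasurableSpace Ω] {P : Measure Ω} [IsProbabilityMeasure P]
  [mα : MeasurableSpace α] [MeasurableSpace β] {μ : Measure α} {ν : Measure β}
  [IsProbabilityMeasure ν] {X : Ω → α} {Z : Ω → β}

/-- The conditional probability of an event about two independent variables given the first one is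
the probability of the section. -/
lemma condExp_indicator_ae_eq_section (hX : MeasurePreserving X P μ)
    (hXZ : MeasurePreserving (fun ω => (X ω, Z ω)) P (μ.prod ν))
    {S : Set (α × β)} (hS : MeasurableSet S) :
    (fun ω => ν.real (Prod.mk (X ω) ⁻¹' S)) =ᵐ[P]
      P⟦(fun ω => (X ω, Z ω)) ⁻¹' S | MeasurableSpace.comap X mα⟧ := by
  have hm : MeasurableSpace.comap X mα ≤ _ := hX.measurable.comap_le
  have hsec : Measurable fun a => ν (Prod.mk a ⁻¹' S) := measurable_measure_prodMk_left hS
  have hS' : MeasurableSet ((fun ω => (X ω, Z ω)) ⁻¹' S) := hXZ.measurable hS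
  have hsecX : Measurable[MeasurableSpace.comap X mα]
      fun ω => ν.real (Prod.mk (X ω) ⁻¹' S) :=
    hsec.ennreal_toReal.comp (comap_measurable X)
  have hint : Integrable (fun ω => ν.real (Prod.mk (X ω) ⁻¹' S)) P :=
    Integrable.of_bound (C := 1) (hsecX.mono hm le_rfl).aestronglyMeasurable
      (Filter.Eventually.of_forall fun ω => by
        rw [Real.norm_eq_abs, abs_of_nonneg measureReal_nonneg]; exact measureReal_le_one)
  refine ae_eq_condExp_of_forall_setIntegral_eq hm ((integrable_const _).indicator hS')
    (fun s _ _ => hint.integrableOn) ?_ hsecX.stronglyMeasurable.aestronglyMeasurable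
  rintro _ ⟨A, hA, rfl⟩ _
  rw [setIntegral_indicator hS', setIntegral_const, smul_eq_mul, mul_one]
  -- Fubini for `S` restricted to the cylinder over `A`.
  have h1 : ∫⁻ ω in X ⁻¹' A, ν (Prod.mk (X ω) ⁻¹' S) ∂P =
      P (X ⁻¹' A ∩ (fun ω => (X ω, Z ω)) ⁻¹' S) := by
    have hT : MeasurableSet ((Prod.fst ⁻¹' A) ∩ S) := (measurable_fst hA).inter hS
    rw [hX.setLIntegral_comp_preimage hA hsec]
    have h2 := hXZ.measure_preimage hT.nullMeasurableSet
    rw [Measure.prod_apply hT] at h2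
    rw [← lintegral_indicator hA]
    refine Eq.trans (lintegral_congr fun a => ?_) h2.symm
    by_cases ha : a ∈ A
    · rw [Set.indicator_of_mem ha]
      congr 1
      ext b
      simp [ha]
    · rw [Set.indicator_of_notMem ha]
      have : Prod.mk a ⁻¹' (Prod.fst ⁻¹' A ∩ S) = ∅ := by
        ext b
        simp [ha]
      rw [this, measure_empty]
  rw [measureReal_def, ← h1]
  exact integral_toReal (hsec.comp hX.measurable).aemeasurable
    (Filter.Eventually.of_forall fun _ => measure_lt_top _ _)

lemma ae_le_condExp_indicator (hX : MeasurePreserving X P μ)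
    (hXZ : MeasurePreserving (fun ω => (X ω, Z ω)) P (μ.prod ν))
    {S : Set (α × β)} (hS : MeasurableSet S) {F : Set Ω} (hF : MeasurableSet F)
    (hSF : (fun ω => (X ω, Z ω)) ⁻¹' S ⊆ F) {g : α → ℝ}
    (hg : ∀ᵐ a ∂μ, g a ≤ ν.real (Prod.mk a ⁻¹' S)) :
    ∀ᵐ ω ∂P, g (X ω) ≤ (P⟦F | MeasurableSpace.comap X mα⟧) ω := by
  have hmono : P⟦(fun ω => (X ω, Z ω)) ⁻¹' S | MeasurableSpace.comap X mα⟧ ≤ᵐ[P]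
      P⟦F | MeasurableSpace.comap X mα⟧ :=
    condExp_mono ((integrable_const _).indicator (hXZ.measurable hS))
      ((integrable_const _).indicator hF)
      (Filter.Eventually.of_forall fun ω =>
        Set.indicator_le_indicator_of_subset hSF (fun _ => zero_le_one) ω)
  filter_upwards [condExp_indicator_ae_eq_section hX hXZ hS, hmono,
    hX.quasiMeasurePreserving.ae hg] with ω h1 h2 h3
  rw [h1] at h3
  exact h3.trans h2

end conditional

/-! ### Conditional failure when a closest pair is matched. -/

section converse

variable {n d m : ℕ} {Ω : Type*} [MeasurableSpace Ω] {P : Measure Ω} [IsProbabilityMeasure P]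
  {θ : Fin n → Option (Fin n)} {B : Matrix (Fin d) (Fin m) ℝ} {σ : ℝ}
  {x : Fin n → Ω → E d} {y ε : Fin n → Ω → E m} {τ : Ω → ℝ} {jhat : Ω → Fin n → Fin n}

lemma separation_of_matched (hθ : ∀ i, θ i ≠ none) (x : Fin n → E d) (y : Fin n → E m) :
    separation θ B σ x y = gammaSq B x * ENNReal.ofReal (SNR B σ) := by
  have h : gammaZeroSq θ B x y = ⊤ := by simp [gammaZeroSq, hθ]
  rw [separation, h, min_eq_right le_top]

lemma measurableSet_recoveryEvent (hx : ∀ i, Measurable (x i)) (hy : ∀ i, Measurable (y i))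
    (hτ : Measurable τ) (hj : Measurable jhat) :
    MeasurableSet (recoveryEvent θ (fun _ => B) τ jhat x y) := by
  -- On `jhat ω i = j` the random index can be replaced by the fixed `j`, which leaves finitely many
  -- measurable conditions.
  have h : recoveryEvent θ (fun _ => B) τ jhat x y =
      ⋂ i, ⋂ j, {ω | (jhat ω i = j ∧ ‖y i ω - linPred B (x j ω)‖ ≤ τ ω) ↔ θ i = some j} := by
    ext ω
    simp only [recoveryEvent, Set.mem_ofPred_eq, Set.mem_iInter, ← Matrix.ext_iff,
      matchingEstimator, matchingMatrix, Matrix.of_apply]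
    refine forall_congr' fun i => forall_congr' fun j => ?_
    have hiff : (j = jhat ω i ∧ ‖y i ω - linPred B (x (jhat ω i) ω)‖ ≤ τ ω) ↔
        (jhat ω i = j ∧ ‖y i ω - linPred B (x j ω)‖ ≤ τ ω) := by
      constructor <;> · rintro ⟨rfl, h⟩; exact ⟨rfl, h⟩
    simp only [hiff]
    split_ifs with h1 h2 h2 <;> simp [h1, h2]
  rw [h]
  refine MeasurableSet.iInter fun i => MeasurableSet.iInter fun j => ?_
  have h1 : MeasurableSet {ω | jhat ω i = j ∧ ‖y i ω - linPred B (x j ω)‖ ≤ τ ω} := by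
    refine MeasurableSet.inter ?_ ?_
    · exact (measurable_pi_iff.1 hj i) (measurableSet_singleton j)
    · exact measurableSet_le
        ((hy i).sub ((measurable_linPred B).comp (hx j))).norm hτ
  by_cases hij : θ i = some j
  · simpa [hij] using h1
  · simpa [hij, Set.compl_ofPred] using h1.compl

/-- On the close event the closest pair is at distance less than `σ/10`, so `‖w‖ / 2 ≤ 1/20` and the
flip has probability above 4/9. The excess over 1/3 is spent on exchangeability; `M + 1` keeps the
constant meaningful at `M = 0`. -/
lemma IsLinkageModel.condExp_failure_ge (h : IsLinkageModel P θ B σ x y ε) {M : ℕ} (hM : m ≤ M)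
    (hB : B ≠ 0) (hσ : 0 < σ) (hτ : Measurable τ) (hjm : Measurable jhat)
    (hj : ∀ ω, IsNearest B (x · ω) (y · ω) (jhat ω)) :
    ∀ᵐ ω ∂P, ω ∈ closeEvent θ B σ x y (1 / (100 * (M + 1))) → (∀ i, θ i ≠ none) →
      ClosestPairMatched θ B (x · ω) →
      4 / 9 ≤ (P⟦(recoveryEvent θ (fun _ => B) τ jhat x y)ᶜ |
          MeasurableSpace.comap (fun ω i => x i ω) inferInstance⟧) ω := by
  have hF := (measurableSet_recoveryEvent (θ := θ) (B := B) h.measurable_x h.measurable_y hτ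
    hjm).compl
  have key : ∀ i j k, θ i = some j → k ≠ j → ∀ᵐ ω ∂P,
      flipBound (‖flipVec B σ (x · ω) j k‖ / 2) ≤
        (P⟦(recoveryEvent θ (fun _ => B) τ jhat x y)ᶜ |
          MeasurableSpace.comap (fun ω i => x i ω) inferInstance⟧) ω := by
    intro i j k hij hkj
    refine ae_le_condExp_indicator h.measurePreserving_x h.measurePreserving_x_ε
      (measurableSet_flipSet (B := B) (σ := σ) i j k) hF (fun ω hω hrec => ?_)
      (g := fun x => flipBound (‖flipVec B σ x j k‖ / 2)) ?_
    · exact notMem_flipSet_of_recovery hσ (fun i j hij => h.matched i j hij ω) (hj ω) hrec hij k hω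
    · filter_upwards [gaussFamily_linPred_sub_ne_zero n hB] with x hx
      exact gaussFamily_halfspace_ge (flipVec_ne_zero hσ (hx _ _ hkj)) i
  -- There are finitely many triples, so one null set serves them all and the pair may depend on
  -- `ω`.
  simp only [← Filter.eventually_imp_distrib_left, ← ae_all_iff] at key
  filter_upwards [key] with ω hω hclose hθ ⟨a, b, hab, hmin, i, hi⟩
  refine le_trans ?_ (hω i a b hi hab.symm)
  have hm : (0 : ℝ) < m := by exact_mod_cast responseDim_pos hB
  have hc : separation θ B σ (x · ω) (y · ω) < ENNReal.ofReal (1 / (100 * (M + 1))) := hclose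
  rw [separation_of_matched hθ, ← hmin,
    ← ENNReal.ofReal_mul (by have := frobSq_pos hB; positivity), div_frobSq_mul_SNR hB,
    ENNReal.ofReal_lt_ofReal_iff (by positivity)] at hc
  have hM' : (m : ℝ) ≤ M := by exact_mod_cast hM
  have ht : ‖flipVec B σ (x · ω) a b‖ / 2 ≤ 1 / 20 := by
    refine le_of_sq_le_sq ?_ (by norm_num)
    rw [norm_flipVec hσ, norm_linPred_sub_comm, div_pow, div_pow]
    rw [div_lt_div_iff₀ (by positivity) (by positivity)] at hc
    rw [div_div, div_le_iff₀ (by positivity)]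
    have h1 : ‖linPred B (x a ω - x b ω)‖ ^ 2 * 100 * (M + 1) < σ ^ 2 * (M + 1) := by
      nlinarith [sq_nonneg σ]
    have h2 := lt_of_mul_lt_mul_right h1 (by positivity)
    linarith
  refine le_trans ?_ (flipBound_anti (by positivity) ht)
  unfold flipBound
  linarith [Real.add_one_le_exp (-((1 / 20 : ℝ) ^ 2 / 2 + 1 / 20))]

end converse

/-! ### Counting permutations. -/

section permutations

/-- At most a quarter of all permutations map two given elements into a set that contains at most
half of all elements. -/
lemma four_mul_card_perm_mem_le {α : Type*} [Fintype α] [DecidableEq α] {N : Finset α}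
    (hN : 2 * N.card ≤ Fintype.card α) {a b : α} (hab : a ≠ b) :
    4 * (Finset.univ.filter fun π : Equiv.Perm α => π a ∈ N ∧ π b ∈ N).card ≤
      Fintype.card (Equiv.Perm α) := by
  set f : α × α → ℕ := fun p =>
    (Finset.univ.filter fun π : Equiv.Perm α => π p.1 ∈ N ∧ π p.2 ∈ N).card with hf
  have hconst : ∀ p ∈ (Finset.univ : Finset α).offDiag, f p = f (a, b) := by
    rintro ⟨i, j⟩ hp
    have hij : i ≠ j := by simpa using hp
    -- Two swaps move `(a, b)` to `(i, j)`; right multiplication by `ρ` then matches the two counts.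
    set ρ : Equiv.Perm α := Equiv.swap (Equiv.swap a i b) j * Equiv.swap a i with hρ
    have ha : ρ a = i := by
      rw [hρ, Equiv.Perm.mul_apply, Equiv.swap_apply_left]
      refine Equiv.swap_apply_of_ne_of_ne (fun h => hab ?_) hij
      exact (Equiv.swap a i).injective (by rw [Equiv.swap_apply_left, ← h])
    have hb : ρ b = j := by
      rw [hρ, Equiv.Perm.mul_apply, Equiv.swap_apply_left]
    refine Finset.card_equiv (Equiv.mulRight ρ) fun π => ?_
    simp [ha, hb]
  -- Double counting: each `π` sends exactly `k(k-1)` ordered pairs into `N`, with `k` its size, and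
  -- `4k(k-1) ≤ l(l-1)` when `2k ≤ l`.
  have hsum : ∑ p ∈ (Finset.univ : Finset α).offDiag, f p =
      Fintype.card (Equiv.Perm α) * N.offDiag.card := by
    simp only [hf, Finset.card_filter]
    rw [Finset.sum_comm, ← Finset.card_univ, ← smul_eq_mul, ← Finset.sum_const]
    refine Finset.sum_congr rfl fun π _ => ?_
    rw [← Finset.card_filter]
    refine Finset.card_equiv (Equiv.prodCongr π π) fun p => ?_
    simp only [Finset.mem_filter, Finset.mem_offDiag, Finset.mem_univ, true_and,
      Equiv.prodCongr_apply, Prod.map, ne_eq, π.injective.eq_iff]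
    tauto
  rw [Finset.sum_congr rfl hconst, Finset.sum_const, smul_eq_mul, Finset.offDiag_card,
    Finset.offDiag_card, Finset.card_univ] at hsum
  change 4 * f (a, b) ≤ _
  have hcard : 1 < Fintype.card α := Fintype.one_lt_card_iff.2 ⟨a, b, hab⟩
  set k := N.card
  set l := Fintype.card α
  have hpos : 0 < l * l - l := by
    rw [Nat.sub_pos_iff_lt]; nlinarith
  refine Nat.le_of_mul_le_mul_left ?_ hpos
  calc (l * l - l) * (4 * f (a, b)) = 4 * ((l * l - l) * f (a, b)) := by ring
    _ = Fintype.card (Equiv.Perm α) * (4 * (k * k - k)) := by rw [hsum]; ring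
    _ ≤ Fintype.card (Equiv.Perm α) * (l * l - l) := by
        refine Nat.mul_le_mul_left _ ?_
        rcases Nat.eq_zero_or_pos k with hk | hk
        · simp [hk]
        · zify [Nat.le_mul_self k, Nat.le_mul_self l]
          zify at hN hk
          nlinarith
    _ = _ := by ring

end permutations

/-! ### Exchangeability and the position of a closest pair. -/

section exchangeability

variable {n d m : ℕ} {θ : Fin n → Option (Fin n)} {B : Matrix (Fin d) (Fin m) ℝ}

lemma measurePreserving_gaussFamily_perm (π : Equiv.Perm (Fin n)) :
    MeasurePreserving (fun (x : Fin n → E d) i => x (π i)) (gaussFamily n d) (gaussFamily n d) :=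
  measurePreserving_arrowCongr' (fun _ => stdGaussian (E d)) (fun _ => stdGaussian (E d)) π.symm
    (MeasurableEquiv.refl _) fun _ => MeasurePreserving.id _

@[fun_prop]
lemma measurable_gammaSq : Measurable (gammaSq B : (Fin n → E d) → ℝ≥0∞) := by
  unfold gammaSq
  refine Measurable.iInf fun i => Measurable.iInf fun j => Measurable.iInf fun _ => ?_
  have h : Measurable fun x : Fin n → E d => x i - x j := by fun_prop
  exact ((((measurable_linPred B).comp h).norm.pow_const 2).div_const _).ennreal_ofReal

lemma measurableSet_closestPairMatched :
    MeasurableSet {x : Fin n → E d | ClosestPairMatched θ B x} := by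
  have h : {x : Fin n → E d | ClosestPairMatched θ B x} = ⋃ i, ⋃ j,
      ⋃ (_ : i ≠ j ∧ some i ∈ Set.range θ),
        {x | ENNReal.ofReal (‖linPred B (x i - x j)‖ ^ 2 / frobSq B) = gammaSq B x} := by
    ext x
    simp only [ClosestPairMatched, Set.mem_ofPred_eq, Set.mem_iUnion, exists_prop]
    exact exists_congr fun i => exists_congr fun j => by tauto
  rw [h]
  refine MeasurableSet.iUnion fun i => MeasurableSet.iUnion fun j => MeasurableSet.iUnion fun _ =>
    measurableSet_eq_fun ?_ (by fun_prop)
  have h : Measurable fun x : Fin n → E d => x i - x j := by fun_prop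
  exact ((((measurable_linPred B).comp h).norm.pow_const 2).div_const _).ennreal_ofReal

lemma exists_eq_gammaSq [Nontrivial (Fin n)] (x : Fin n → E d) : ∃ i j, i ≠ j ∧
    ENNReal.ofReal (‖linPred B (x i - x j)‖ ^ 2 / frobSq B) = gammaSq B x := by
  obtain ⟨a, b, hab⟩ := exists_pair_ne (Fin n)
  have : Nonempty {p : Fin n × Fin n // p.1 ≠ p.2} := ⟨⟨(a, b), hab⟩⟩
  obtain ⟨⟨⟨i, j⟩, hij⟩, hmin⟩ := Finite.exists_min fun p : {p : Fin n × Fin n // p.1 ≠ p.2} =>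
    ENNReal.ofReal (‖linPred B (x p.1.1 - x p.1.2)‖ ^ 2 / frobSq B)
  exact ⟨i, j, hij, le_antisymm (le_iInf fun k => le_iInf fun l => le_iInf fun hkl =>
    hmin ⟨(k, l), hkl.ne⟩) (gammaSq_le hij)⟩

lemma gammaSq_perm (π : Equiv.Perm (Fin n)) (x : Fin n → E d) :
    gammaSq B (fun i => x (π i)) = gammaSq B x := by
  have h : ∀ (π : Equiv.Perm (Fin n)) (x : Fin n → E d),
      gammaSq B x ≤ gammaSq B (fun i => x (π i)) := fun π x =>
    le_iInf fun i => le_iInf fun j => le_iInf fun hij => gammaSq_le (π.injective.ne hij.ne)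
  refine le_antisymm ?_ (h π x)
  simpa using h π.symm (fun i => x (π i))

lemma gammaSq_eq_top (hn : n ≤ 1) (x : Fin n → E d) : gammaSq B x = ⊤ := by
  have : Subsingleton (Fin n) := Fin.subsingleton_iff_le_one.2 hn
  simp only [gammaSq, iInf_eq_top]
  exact fun i j hij => absurd (Subsingleton.elim i j) hij.ne

lemma card_unmatched_le [DecidablePred fun j : Fin n => some j ∉ Set.range θ]
    (hθ : ∀ i, θ i ≠ none) (hr : n ≤ 2 * (Set.range θ).ncard) :
    2 * (Finset.univ.filter fun j : Fin n => some j ∉ Set.range θ).card ≤ n := by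
  classical
  have h1 : (Set.range θ).ncard =
      (Finset.univ.filter fun j : Fin n => some j ∈ Set.range θ).card := by
    rw [← Finset.card_map Function.Embedding.some, ← Set.ncard_coe_finset]
    congr 1
    ext o
    rcases o with _ | j
    · simpa using fun i => hθ i
    · simp
  have h2 := Finset.card_filter_add_card_filter_not (s := (Finset.univ : Finset (Fin n)))
    (fun j => some j ∈ Set.range θ)
  rw [Finset.card_univ, Fintype.card_fin] at h2
  have h3 : (Finset.univ.filter fun j : Fin n => some j ∉ Set.range θ).card =
    (Finset.univ.filter fun j : Fin n => ¬ some j ∈ Set.range θ).card := by congr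
  omega

/-- If at least half of the predictors are matched, then, by exchangeability, the closest pair
contains a matched predictor with conditional probability at least `3 / 4`, given the size of the
smallest gap. -/
lemma four_mul_not_closestPairMatched_le (hθ : ∀ i, θ i ≠ none)
    (hr : n ≤ 2 * (Set.range θ).ncard) {s : Set ℝ≥0∞} (hs : MeasurableSet s) (hsn : n ≤ 1 → ⊤ ∉ s) :
    4 * gaussFamily n d (gammaSq B ⁻¹' s ∩ {x | ClosestPairMatched θ B x}ᶜ) ≤
      gaussFamily n d (gammaSq B ⁻¹' s) := by
  classical
  rcases le_or_gt n 1 with hn | hn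
  · have : (gammaSq B ⁻¹' s : Set (Fin n → E d)) = ∅ := by
      ext x
      simp [gammaSq_eq_top hn, hsn hn]
    simp [this]
  have : Nontrivial (Fin n) := Fin.nontrivial_iff_two_le.2 hn
  set K : Set (Fin n → E d) := gammaSq B ⁻¹' s
  set W : Set (Fin n → E d) := {x | ClosestPairMatched θ B x}ᶜ
  have hK : MeasurableSet K := measurable_gammaSq hs
  have hW : MeasurableSet W := measurableSet_closestPairMatched.compl
  set N := Finset.univ.filter fun j : Fin n => some j ∉ Set.range θ
  have hN : 2 * N.card ≤ Fintype.card (Fin n) := by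
    rw [Fintype.card_fin]; exact card_unmatched_le hθ hr
  -- All permuted copies of the bad set have the same measure. Pointwise, at most a quarter of them
  -- contain a given `x`; integrating and cancelling `n!` gives the claim.
  set T : Equiv.Perm (Fin n) → Set (Fin n → E d) := fun π => (fun x i => x (π i)) ⁻¹' (K ∩ W)
  have hTm : ∀ π, MeasurableSet (T π) := fun π =>
    (measurePreserving_gaussFamily_perm π).measurable (hK.inter hW)
  have hT : ∀ π, gaussFamily n d (T π) = gaussFamily n d (K ∩ W) := fun π =>
    (measurePreserving_gaussFamily_perm π).measure_preimage (hK.inter hW).nullMeasurableSet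
  have hTK : ∀ π x, x ∈ T π → x ∈ K := by
    intro π x hx
    have h := hx.1
    simpa only [K, Set.mem_preimage, gammaSq_perm] using h
  set c := Fintype.card (Equiv.Perm (Fin n))
  have hpt : ∀ x, 4 * ∑ π, (T π).indicator (1 : (Fin n → E d) → ℝ≥0∞) x ≤
      K.indicator (fun _ => (c : ℝ≥0∞)) x := by
    intro x
    by_cases hx : x ∈ K
    · obtain ⟨a, b, hab, hmin⟩ := exists_eq_gammaSq (B := B) x
      rw [Set.indicator_of_mem hx]
      have hle : ∑ π, (T π).indicator (1 : (Fin n → E d) → ℝ≥0∞) x ≤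
          ((Finset.univ.filter fun π : Equiv.Perm (Fin n) => π a ∈ N ∧ π b ∈ N).card : ℝ≥0∞) := by
        -- Inverses are taken because relabelling by `π⁻¹` moves the closest pair `(a, b)` of `x` to
        -- `(π a, π b)`, both of which must be unmatched on the bad set.
        rw [← Equiv.sum_comp (Equiv.inv (Equiv.Perm (Fin n))), Finset.card_filter]
        push_cast
        refine Finset.sum_le_sum fun π _ => ?_
        by_cases hπ : x ∈ T π⁻¹
        · have hnot : ¬ ClosestPairMatched θ B fun i => x (π⁻¹ i) := hπ.2
          have hpair : ∀ i j, i ≠ j →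
              ENNReal.ofReal (‖linPred B (x i - x j)‖ ^ 2 / frobSq B) = gammaSq B x →
              π i ∈ N := by
            intro i j hij hm
            simp only [N, Finset.mem_filter, Finset.mem_univ, true_and]
            intro hi
            refine hnot ⟨π i, π j, π.injective.ne hij, ?_, hi⟩
            rw [gammaSq_perm π⁻¹]
            simpa using hm
          have ha := hpair a b hab hmin
          have hb := hpair b a hab.symm (by rwa [norm_linPred_sub_comm])
          rw [if_pos ⟨ha, hb⟩]
          exact Set.indicator_le_self' (fun _ _ => zero_le) _
        · simp only [Equiv.inv_apply, Set.indicator_of_notMem hπ]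
          exact zero_le
      calc _ ≤ 4 * ((Finset.univ.filter fun π : Equiv.Perm (Fin n) =>
            π a ∈ N ∧ π b ∈ N).card : ℝ≥0∞) := by gcongr
        _ ≤ c := by exact_mod_cast four_mul_card_perm_mem_le hN hab
    · rw [Set.indicator_of_notMem hx, Finset.sum_eq_zero fun π _ =>
        Set.indicator_of_notMem (fun h => hx (hTK π x h)) _, mul_zero]
  have hint := lintegral_mono (μ := gaussFamily n d) hpt
  rw [lintegral_const_mul _ (Finset.measurable_sum _ fun π _ =>
      measurable_one.indicator (hTm π)),
    lintegral_finsetSum _ fun π _ => measurable_one.indicator (hTm π),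
    lintegral_indicator_const hK] at hint
  simp_rw [lintegral_indicator_one (hTm _), hT] at hint
  rw [Finset.sum_const, Finset.card_univ, nsmul_eq_mul, mul_left_comm] at hint
  exact (ENNReal.mul_le_mul_iff_right (by simp [Fintype.card_ne_zero])
    (ENNReal.natCast_ne_top _)).1 hint

end exchangeability

/-! ### Failure conditional on the close event. -/

section converse

variable {n d m : ℕ} {Ω : Type*} [MeasurableSpace Ω] {P : Measure Ω} [IsProbabilityMeasure P]
  {θ : Fin n → Option (Fin n)} {B : Matrix (Fin d) (Fin m) ℝ} {σ : ℝ}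
  {x : Fin n → Ω → E d} {y ε : Fin n → Ω → E m} {τ : Ω → ℝ} {jhat : Ω → Fin n → Fin n}

lemma IsLinkageModel.cond_failure_ge (h : IsLinkageModel P θ B σ x y ε) {M : ℕ} (hM : m ≤ M)
    (hB : B ≠ 0) (hσ : 0 < σ) (hθ : ∀ i, θ i ≠ none) (hτ : Measurable τ) (hjm : Measurable jhat)
    (hj : ∀ ω, IsNearest B (x · ω) (y · ω) (jhat ω)) (hr : n ≤ 2 * (Set.range θ).ncard)
    (hC : P (closeEvent θ B σ x y (1 / (100 * (M + 1)))) ≠ 0) :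
    1 / 3 ≤ (ProbabilityTheory.cond P (closeEvent θ B σ x y (1 / (100 * (M + 1))))).real
      (recoveryEvent θ (fun _ => B) τ jhat x y)ᶜ := by
  set F := (recoveryEvent θ (fun _ => B) τ jhat x y)ᶜ
  have hFm : MeasurableSet F :=
    (measurableSet_recoveryEvent h.measurable_x h.measurable_y hτ hjm).compl
  set s : Set ℝ≥0∞ := {a | a * ENNReal.ofReal (SNR B σ) <
    ENNReal.ofReal (1 / (100 * ((M : ℝ) + 1)))} with hs
  have hsm : MeasurableSet s := measurableSet_lt (by fun_prop) measurable_const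
  have hm : (0 : ℝ) < m := by exact_mod_cast responseDim_pos hB
  have hsnr : 0 < SNR B σ := div_pos (frobSq_pos hB) (by positivity)
  have htop : n ≤ 1 → ⊤ ∉ s := fun _ => by simp [hs, ENNReal.top_mul, hsnr]
  set X : Ω → Fin n → E d := fun ω i => x i ω
  have hXP : MeasurePreserving X P (gaussFamily n d) := h.measurePreserving_x
  set K : Set (Fin n → E d) := gammaSq B ⁻¹' s
  set W : Set (Fin n → E d) := {x | ClosestPairMatched θ B x}
  have hK : MeasurableSet K := measurable_gammaSq hsm
  have hW : MeasurableSet W := measurableSet_closestPairMatched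
  have hCK : closeEvent θ B σ x y (1 / (100 * (M + 1))) = X ⁻¹' K := by
    ext ω
    simp only [closeEvent, separation_of_matched hθ, K, s, X, Set.mem_preimage, Set.mem_ofPred_eq]
  have hCm : MeasurableSet (X ⁻¹' K) := hXP.measurable hK
  have hDm : MeasurableSet (X ⁻¹' (K ∩ W)) := hXP.measurable (hK.inter hW)
  have hexch : 3 / 4 * P.real (X ⁻¹' K) ≤ P.real (X ⁻¹' (K ∩ W)) := by
    have h1 := four_mul_not_closestPairMatched_le (d := d) (B := B) hθ hr hsm htop
    have h2 := ENNReal.toReal_mono (by finiteness) h1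
    rw [ENNReal.toReal_mul] at h2
    change (4 : ℝ≥0∞).toReal * (gaussFamily n d).real (K ∩ Wᶜ) ≤ (gaussFamily n d).real K at h2
    have h3 := measureReal_inter_add_sdiff (μ := gaussFamily n d) (s := K) hW
    rw [Set.sdiff_eq] at h3
    rw [hXP.measureReal_preimage hK.nullMeasurableSet,
      hXP.measureReal_preimage (hK.inter hW).nullMeasurableSet]
    norm_num at h2
    linarith
  -- The set `X ⁻¹' (K ∩ W)` is determined by `X`, so the almost sure bound can be integrated over
  -- it.
  have hfail : 4 / 9 * P.real (X ⁻¹' (K ∩ W)) ≤ P.real (X ⁻¹' (K ∩ W) ∩ F) := by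
    have hle : MeasurableSpace.comap X inferInstance ≤ _ := hXP.measurable.comap_le
    have h1 : ∫ ω in X ⁻¹' (K ∩ W), (P⟦F | MeasurableSpace.comap X inferInstance⟧) ω ∂P =
        P.real (X ⁻¹' (K ∩ W) ∩ F) := by
      rw [setIntegral_condExp hle ((integrable_const _).indicator hFm)
        ⟨K ∩ W, hK.inter hW, rfl⟩, setIntegral_indicator hFm, setIntegral_const, smul_eq_mul,
        mul_one]
    rw [← h1, mul_comm, ← smul_eq_mul, ← setIntegral_const]
    refine setIntegral_mono_ae_restrict (integrable_const _) integrable_condExp.integrableOn ?_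
    rw [Filter.EventuallyLE, ae_restrict_iff' hDm]
    filter_upwards [h.condExp_failure_ge hM hB hσ hτ hjm hj] with ω hω hωD
    exact hω (hCK ▸ hωD.1) hθ hωD.2
  rw [hCK] at hC ⊢
  have hpos : 0 < P.real (X ⁻¹' K) :=
    ENNReal.toReal_pos hC (measure_ne_top _ _)
  rw [measureReal_def, cond_apply hCm, ENNReal.toReal_mul, ENNReal.toReal_inv,
    ← measureReal_def, ← measureReal_def, ← div_eq_inv_mul, le_div_iff₀ hpos]
  have hmono : P.real (X ⁻¹' (K ∩ W) ∩ F) ≤ P.real (X ⁻¹' K ∩ F) :=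
    measureReal_mono (Set.inter_subset_inter_left _ (Set.preimage_mono Set.inter_subset_left))
  linarith

end converse

end RecordLinkage

end

theorem theorem2 :
    -- Achievability.
    (∀ (n d m : ℕ) (Ω : Type*) [MeasurableSpace Ω] (P : Measure Ω) [IsProbabilityMeasure P]
        (θ : Fin n → Option (Fin n)) (B : Matrix (Fin d) (Fin m) ℝ) (σ : ℝ)
        (x : Fin n → Ω → RecordLinkage.E d) (y ε : Fin n → Ω → RecordLinkage.E m)
        (Bhat : (Fin n → RecordLinkage.E d) → (Fin n → RecordLinkage.E m) →
          Matrix (Fin d) (Fin m) ℝ)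
        (τ : Ω → ℝ) (jhat : Ω → Fin n → Fin n),
      0 < n → B ≠ 0 → 0 < σ →
      RecordLinkage.IsLinkageModel P θ B σ x y ε →
      (∀ k l, Measurable fun p : (Fin n → RecordLinkage.E d) × (Fin n → RecordLinkage.E m) =>
        Bhat p.1 p.2 k l) →
      Measurable τ → Measurable jhat →
      (∀ᵐ ω ∂P, RecordLinkage.tauZero B (RecordLinkage.plugIn Bhat x y ω) σ (x · ω) < τ ω) →
      (∀ ω, RecordLinkage.IsNearest (RecordLinkage.plugIn Bhat x y ω) (x · ω) (y · ω) (jhat ω)) →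
      1 - P.real (RecordLinkage.goodEvent θ B (RecordLinkage.plugIn Bhat x y) σ τ x y)ᶜ - 1 / n ≤
          P.real (RecordLinkage.goodEvent θ B (RecordLinkage.plugIn Bhat x y) σ τ x y ∩
            RecordLinkage.recoveryEvent θ (RecordLinkage.plugIn Bhat x y) τ jhat x y) ∧
        (P (RecordLinkage.goodEvent θ B (RecordLinkage.plugIn Bhat x y) σ τ x y) ≠ 0 →
          1 - P.real (RecordLinkage.goodEvent θ B (RecordLinkage.plugIn Bhat x y) σ τ x y)ᶜ
              - 1 / n ≤
            (ProbabilityTheory.cond P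
              (RecordLinkage.goodEvent θ B (RecordLinkage.plugIn Bhat x y) σ τ x y)).real
              (RecordLinkage.recoveryEvent θ (RecordLinkage.plugIn Bhat x y) τ jhat x y))) ∧
    -- Converse, for arbitrary `m`.
    (∃ c : ℝ, 0 < c ∧
      ∀ (n d m : ℕ) (Ω : Type*) [MeasurableSpace Ω] (P : Measure Ω) [IsProbabilityMeasure P]
        (θ : Fin n → Option (Fin n)) (B : Matrix (Fin d) (Fin m) ℝ) (σ : ℝ)
        (x : Fin n → Ω → RecordLinkage.E d) (y ε : Fin n → Ω → RecordLinkage.E m)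
        (τ : Ω → ℝ) (jhat : Ω → Fin n → Fin n),
      B ≠ 0 → 0 < σ → (∀ i, θ i ≠ none) →
      RecordLinkage.IsLinkageModel P θ B σ x y ε →
      Measurable τ → Measurable jhat →
      (∀ ω, RecordLinkage.IsNearest B (x · ω) (y · ω) (jhat ω)) →
      RecordLinkage.SNR B σ < c * (Real.log n / m) →
      1 / 3 ≤ P.real (RecordLinkage.recoveryEvent θ (fun _ => B) τ jhat x y)ᶜ) ∧
    -- Converse, for bounded `m`.
    (∀ M : ℕ, ∃ c' : ℝ, 0 < c' ∧
      ∀ (n d m : ℕ) (Ω : Type*) [MeasurableSpace Ω] (P : Measure Ω) [IsProbabilityMeasure P]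
        (θ : Fin n → Option (Fin n)) (B : Matrix (Fin d) (Fin m) ℝ) (σ : ℝ)
        (x : Fin n → Ω → RecordLinkage.E d) (y ε : Fin n → Ω → RecordLinkage.E m)
        (τ : Ω → ℝ) (jhat : Ω → Fin n → Fin n),
      m ≤ M → B ≠ 0 → 0 < σ → (∀ i, θ i ≠ none) →
      RecordLinkage.IsLinkageModel P θ B σ x y ε →
      Measurable τ → Measurable jhat →
      (∀ ω, RecordLinkage.IsNearest B (x · ω) (y · ω) (jhat ω)) →
      (∀ᵐ ω ∂P, ω ∈ RecordLinkage.closeEvent θ B σ x y c' →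
        RecordLinkage.ClosestPairMatched θ B (x · ω) →
        1 / 3 ≤ (P⟦(RecordLinkage.recoveryEvent θ (fun _ => B) τ jhat x y)ᶜ |
          MeasurableSpace.comap (fun ω i => x i ω) inferInstance⟧) ω) ∧
      (n ≤ 2 * (Set.range θ).ncard → P (RecordLinkage.closeEvent θ B σ x y c') ≠ 0 →
        1 / 3 ≤ (ProbabilityTheory.cond P (RecordLinkage.closeEvent θ B σ x y c')).real
          (RecordLinkage.recoveryEvent θ (fun _ => B) τ jhat x y)ᶜ)) := by
  open RecordLinkage in
  refine ⟨?_, ⟨1 / 440, by norm_num, ?_⟩, fun M => ⟨1 / (100 * (M + 1)), by positivity, ?_⟩⟩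
  · intro n d m Ω _ P _ θ B σ x y ε Bhat τ jhat hn hB hσ h _ _ _ hτ hj
    have hmain := h.achievability hn hB hσ hτ hj
    exact ⟨hmain, fun hG => hmain.trans (measureReal_inter_le_cond hG _)⟩
  · intro n d m Ω _ P _ θ B σ x y ε τ jhat hB hσ hθ h _ _ hj hsnr
    have h1 := h.recovery_le (τ := τ) hB hσ hθ hj hsnr
    -- Subadditivity passes to the complement without measurability of the recovery event.
    have h2 := measureReal_union_le (μ := P) (recoveryEvent θ (fun _ => B) τ jhat x y)
      (recoveryEvent θ (fun _ => B) τ jhat x y)ᶜ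
    rw [Set.union_compl_self, probReal_univ] at h2
    linarith
  · intro n d m Ω _ P _ θ B σ x y ε τ jhat hM hB hσ hθ h hτ hjm hj
    refine ⟨?_, fun hr hC => h.cond_failure_ge hM hB hσ hθ hτ hjm hj hr hC⟩
    filter_upwards [h.condExp_failure_ge hM hB hσ hτ hjm hj] with ω hω hc hp
    exact le_trans (by norm_num) (hω hc hθ hp)
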